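/- Let $d\in\{1,2,3\}$ and $\varepsilon>0$. For a finite real-valued Radon measure $\mu=\mu^+-\mu^-$ on $\mathbb R^d$ (Hahn--Jordan decomposition) put $|\mu|=\mu^++\mu^-$ and $\|\mu\|=|\mu|(\mathbb R^d)$, and let $-\Delta+\varepsilon^2\Delta^2+\mu$ be the operator in $L^2(\mathbb R^d,dx)$ associated to the quadratic form $$\mathcal E^\mu_\varepsilon(f,f)=\varepsilon^2(\Delta f,\Delta f)+(\nabla f,\nabla f)+\int|\tilde f|^2\,d\mu,\qquad f\in D(\mathcal E^\mu_\varepsilon)=H^2(\mathbb R^d),$$ where $\tilde f$ is the unique continuous representative of $f$. For $\alpha>0$ and either $\varepsilon>0$ or $\varepsilon=0$ let $g_{\varepsilon,\alpha}$ be the Green function of $-\Delta+\varepsilon^2\Delta^2+\alpha$, i.e. $(-\Delta+\varepsilon^2\Delta^2+\alpha)^{-1}$ is the convolution with $g_{\varepsilon,\alpha}$ (chosen continuous if $\varepsilon>0$). There are finite constants $C_j=C_j(\varepsilon,\alpha)$, $j=1,2$ (depending only on $d,\varepsilon,\alpha$), such that the following holds. Let $m$ and $\mu_n$, $n\in\mathbb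 N$, be finite real-valued Radon measures on $\mathbb R^d$ with $\sup_n\|\mu_n\|<\infty$ and $\mu_n\to m$ weakly, i.e. $\int f\,d\mu_n\to\int f\,dm$ for every bounded continuous $f$. Then the operators $-\Delta+\varepsilon^2\Delta^2+\mu_n$ and $-\Delta+\varepsilon^2\Delta^2+m$ are self-adjoint and bounded from below, and $$-\Delta+\varepsilon^2\Delta^2+\mu_n\longrightarrow-\Delta+\varepsilon^2\Delta^2+m\quad\text{in the norm resolvent sense.}$$ Moreover, there is an $\alpha_0>0$ such that for every $\alpha\ge\alpha_0$ the resolvents below exist and, for all $n$, $$\big\|(-\Delta+\varepsilon^2\Delta^2+\mu_n+\alpha)^{-1}-(-\Delta+\varepsilon^2\Delta^2+m+\alpha)^{-1}\big\|^2$$ $$\le C_1\int\!\!\int\Big|\int g_{0,1}(y-a)\,g_{\varepsilon,\alpha}(x-y)\,(m-\mu_n)(dy)\Big|^2da\,dx+C_2\int\!\!\int\Big|\int g_{0,1}(y-a)\,g_{\varepsilon,\alpha}(x-y)\,(m-\mu_n)(dy)\Big|^2da\,|m|(dx),$$ and both double integrals tend to $0$ as $n\to\infty$. -/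

import Mathlib

open MeasureTheory Filter Topology
open scoped ENNReal NNReal SchwartzMap FourierTransform Laplacian LineDeriv BoundedContinuousFunction

noncomputable section

namespace MeasurePerturbation

/-! ### Function spaces -/

/-- The Euclidean space `ℝ^d`. -/
abbrev Space (d : ℕ) : Type := EuclideanSpace ℝ (Fin d)

/-- The complex Hilbert space `L²(ℝ^d, dx)`. -/
abbrev L2 (d : ℕ) : Type := Lp ℂ 2 (volume : Measure (Space d))

/-- The Sobolev space `H²(ℝ^d)`, as a subspace of `L²(ℝ^d, dx)`. -/
def H2 (d : ℕ) : Submodule ℂ (L2 d) where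
  carrier := {f | TemperedDistribution.MemSobolev 2 2 (f : 𝓢'(Space d, ℂ))}
  zero_mem' := by
    have h := TemperedDistribution.memSobolev_fun_zero (Space d) ℂ 2 2
    rw [← map_zero (Lp.toTemperedDistributionCLM ℂ (volume : Measure (Space d)) 2)] at h
    exact h
  add_mem' := by
    intro f g hf hg
    have h := TemperedDistribution.MemSobolev.add hf hg
    rw [← Lp.toTemperedDistributionCLM_apply, ← Lp.toTemperedDistributionCLM_apply,
      ← map_add] at h
    exact h
  smul_mem' := by
    intro c f hf
    have h := TemperedDistribution.MemSobolev.smul c hf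
    rw [← Lp.toTemperedDistributionCLM_apply, ← map_smul] at h
    exact h

theorem L2.toTemperedDistribution_injective (d : ℕ) :
    Function.Injective fun f : L2 d => (f : 𝓢'(Space d, ℂ)) := by
  have h := Lp.ker_toTemperedDistributionCLM_eq_bot (F := ℂ)
    (μ := (volume : Measure (Space d))) (p := 2)
  exact LinearMap.ker_eq_bot.mp h

/-- A linear map on tempered distributions that sends `H²` into `L²`, as a map `H² → L²`. -/
def restrictH2 {d : ℕ} (T : 𝓢'(Space d, ℂ) →ₗ[ℂ] 𝓢'(Space d, ℂ))
    (hT : ∀ f : H2 d, ∃ g : L2 d, T ((f : L2 d) : 𝓢'(Space d, ℂ)) = g) : H2 d →ₗ[ℂ] L2 d where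
  toFun f := (hT f).choose
  map_add' := by
    intro f g
    apply L2.toTemperedDistribution_injective d
    change ((hT (f + g)).choose : 𝓢'(Space d, ℂ)) =
      Lp.toTemperedDistributionCLM ℂ volume 2 ((hT f).choose + (hT g).choose)
    rw [map_add, Lp.toTemperedDistributionCLM_apply, Lp.toTemperedDistributionCLM_apply,
      ← (hT f).choose_spec, ← (hT g).choose_spec, ← (hT (f + g)).choose_spec, ← map_add]
    congr 1
    exact map_add (Lp.toTemperedDistributionCLM ℂ volume 2) (f : L2 d) (g : L2 d)
  map_smul' := by
    intro c f
    apply L2.toTemperedDistribution_injective d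
    change ((hT (c • f)).choose : 𝓢'(Space d, ℂ)) =
      Lp.toTemperedDistributionCLM ℂ volume 2 (c • (hT f).choose)
    rw [map_smul, Lp.toTemperedDistributionCLM_apply,
      ← (hT f).choose_spec, ← (hT (c • f)).choose_spec, ← map_smul]
    congr 1
    exact map_smul (Lp.toTemperedDistributionCLM ℂ volume 2) c (f : L2 d)

theorem restrictH2_spec {d : ℕ} (T : 𝓢'(Space d, ℂ) →ₗ[ℂ] 𝓢'(Space d, ℂ))
    (hT : ∀ f : H2 d, ∃ g : L2 d, T ((f : L2 d) : 𝓢'(Space d, ℂ)) = g) (f : H2 d) :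
    (restrictH2 T hT f : 𝓢'(Space d, ℂ)) = T ((f : L2 d) : 𝓢'(Space d, ℂ)) :=
  (hT f).choose_spec.symm

theorem exists_laplacian {d : ℕ} (f : H2 d) :
    ∃ g : L2 d, (Δ ((f : L2 d) : 𝓢'(Space d, ℂ)) : 𝓢'(Space d, ℂ)) = g := by
  have h := TemperedDistribution.MemSobolev.laplacian f.2
  rw [sub_self] at h
  exact TemperedDistribution.memSobolev_zero_iff.mp h

theorem exists_partial {d : ℕ} (j : Fin d) (f : H2 d) :
    ∃ g : L2 d, (∂_{EuclideanSpace.single j (1 : ℝ)} ((f : L2 d) : 𝓢'(Space d, ℂ)) :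
      𝓢'(Space d, ℂ)) = g := by
  have h := TemperedDistribution.MemSobolev.lineDerivOp f.2
    (m := EuclideanSpace.single j (1 : ℝ))
  exact TemperedDistribution.memSobolev_zero_iff.mp (h.mono (by norm_num))

/-- The distributional Laplacian `Δ : H² → L²`. -/
def laplacianH2 (d : ℕ) : H2 d →ₗ[ℂ] L2 d :=
  restrictH2 (LineDeriv.laplacianCLM ℂ (Space d) 𝓢'(Space d, ℂ)).toLinearMap fun f => by
    simpa [TemperedDistribution.laplacianCLM_apply] using exists_laplacian f

/-- The distributional partial derivative `∂ⱼ : H² → L²`. -/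
def partialH2 {d : ℕ} (j : Fin d) : H2 d →ₗ[ℂ] L2 d :=
  restrictH2 (LineDeriv.lineDerivOpCLM ℂ 𝓢'(Space d, ℂ)
    (EuclideanSpace.single j (1 : ℝ) : Space d)).toLinearMap (exists_partial j)

/-! ### The continuous representative -/

theorem exists_continuous_rep {d : ℕ} (hd : d ≤ 3) (f : H2 d) :
    ∃ g : Space d →ᵇ ℂ, (f : L2 d) =ᵐ[volume] g := by
  have hs : (Module.finrank ℝ (Space d) : ℝ) < 2 * (2 : ℝ) := by
    rw [finrank_euclideanSpace_fin]
    have : (d : ℝ) ≤ 3 := by exact_mod_cast hd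
    linarith
  obtain ⟨v, hv⟩ := TemperedDistribution.MemSobolev.fourier_memL1 hs f.2
  have hvi : Integrable (v : Space d → ℂ) := L1.integrable_coeFn v
  have hL : Continuous fun p : Space d × Space d => (-innerₗ (Space d)) p.1 p.2 := by
    simp only [LinearMap.neg_apply, innerₗ_apply_apply]
    fun_prop
  have hc : Continuous (𝓕⁻ (v : Space d → ℂ)) :=
    VectorFourier.fourierIntegral_continuous Real.continuous_fourierChar hL hvi
  have hb : ∀ x, ‖𝓕⁻ (v : Space d → ℂ) x‖ ≤ ∫ y, ‖(v : Space d → ℂ) y‖ := fun x =>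
    VectorFourier.norm_fourierIntegral_le_integral_norm _ _ _ _ x
  refine ⟨BoundedContinuousFunction.ofNormedAddCommGroup _ hc _ hb, ?_⟩
  refine ae_eq_of_integral_contDiff_smul_eq
    ((Lp.memLp (f : L2 d)).locallyIntegrable (by norm_num)) hc.locallyIntegrable ?_
  intro u hu huc
  have hu1 : HasCompactSupport (Complex.ofRealCLM ∘ u) := huc.comp_left rfl
  have hu2 : ContDiff ℝ (⊤ : ℕ∞) (Complex.ofRealCLM ∘ u) := by fun_prop
  set φ : 𝓢(Space d, ℂ) := hu1.toSchwartzMap hu2 with hφ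
  have hφi : Integrable (φ : Space d → ℂ) := φ.integrable
  calc ∫ x, u x • (f : L2 d) x = ((f : L2 d) : 𝓢'(Space d, ℂ)) φ := by
        simp [φ]
    _ = (𝓕 ((f : L2 d) : 𝓢'(Space d, ℂ))) (𝓕⁻ φ) := by
        rw [TemperedDistribution.fourier_apply, FourierTransform.fourier_fourierInv_eq]
    _ = ∫ ξ, 𝓕⁻ (φ : Space d → ℂ) ξ • (v : Space d → ℂ) ξ := by
        rw [hv, Lp.toTemperedDistribution_apply, SchwartzMap.fourierInv_coe]
    _ = ∫ x, φ x • 𝓕⁻ (v : Space d → ℂ) x := by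
        have h := VectorFourier.integral_fourierIntegral_smul_eq_flip
          Real.continuous_fourierChar hL hφi hvi
        have hflip : (-innerₗ (Space d)).flip = -innerₗ (Space d) := by
          ext x y
          simp [real_inner_comm]
        rw [hflip] at h
        exact h
    _ = _ := by
        simp [φ]

/-- The unique continuous representative of a function in `H²(ℝ^d)`, `d ≤ 3`; it is bounded. -/
def contRep {d : ℕ} (hd : d ≤ 3) : H2 d →ₗ[ℂ] (Space d →ᵇ ℂ) where
  toFun f := (exists_continuous_rep hd f).choose
  map_add' := by
    intro f g
    have h1 := (exists_continuous_rep hd f).choose_spec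
    have h2 := (exists_continuous_rep hd g).choose_spec
    have h3 := (exists_continuous_rep hd (f + g)).choose_spec
    apply DFunLike.coe_injective
    refine (Continuous.ae_eq_iff_eq volume (BoundedContinuousFunction.continuous _)
      (BoundedContinuousFunction.continuous _)).mp ?_
    refine h3.symm.trans ((Lp.coeFn_add (f : L2 d) (g : L2 d)).trans ?_)
    exact h1.add h2
  map_smul' := by
    intro c f
    have h1 := (exists_continuous_rep hd f).choose_spec
    have h3 := (exists_continuous_rep hd (c • f)).choose_spec
    apply DFunLike.coe_injective
    refine (Continuous.ae_eq_iff_eq volume (BoundedContinuousFunction.continuous _)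
      (BoundedContinuousFunction.continuous _)).mp ?_
    refine h3.symm.trans ((Lp.coeFn_smul c (f : L2 d)).trans ?_)
    exact h1.const_smul c

theorem contRep_spec {d : ℕ} (hd : d ≤ 3) (f : H2 d) :
    (f : L2 d) =ᵐ[volume] contRep hd f :=
  (exists_continuous_rep hd f).choose_spec

/-! ### Finite real-valued Radon measures -/

/-- The integral `∫ f dμ = ∫ f dμ⁺ - ∫ f dμ⁻` with respect to a finite real-valued measure, where
`μ = μ⁺ - μ⁻` is the Hahn-Jordan decomposition. -/
def signedIntegral {X F : Type*} [MeasurableSpace X] [NormedAddCommGroup F] [NormedSpace ℝ F]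
    (μ : SignedMeasure X) (f : X → F) : F :=
  (∫ x, f x ∂μ.toJordanDecomposition.posPart) - ∫ x, f x ∂μ.toJordanDecomposition.negPart

theorem signedIntegral_add {X : Type*} [MeasurableSpace X] {μ : SignedMeasure X} {f g : X → ℂ}
    (hf : Integrable f μ.toJordanDecomposition.posPart)
    (hg : Integrable g μ.toJordanDecomposition.posPart)
    (hf' : Integrable f μ.toJordanDecomposition.negPart)
    (hg' : Integrable g μ.toJordanDecomposition.negPart) :
    signedIntegral μ (fun x => f x + g x) = signedIntegral μ f + signedIntegral μ g := by
  simp only [signedIntegral]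
  rw [integral_add hf hg, integral_add hf' hg']
  ring

theorem signedIntegral_const_mul {X : Type*} [MeasurableSpace X] (μ : SignedMeasure X) (c : ℂ)
    (f : X → ℂ) : signedIntegral μ (fun x => c * f x) = c * signedIntegral μ f := by
  simp only [signedIntegral, integral_const_mul, mul_sub]

theorem integrable_rep {d : ℕ} (μ : SignedMeasure (Space d)) (f g : Space d →ᵇ ℂ) :
    Integrable (fun x => starRingEnd ℂ (f x) * g x) μ.toJordanDecomposition.posPart ∧
      Integrable (fun x => starRingEnd ℂ (f x) * g x) μ.toJordanDecomposition.negPart := by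
  have h : ∀ ρ : Measure (Space d), IsFiniteMeasure ρ →
      Integrable (fun x => starRingEnd ℂ (f x) * g x) ρ := fun ρ _ =>
    (BoundedContinuousFunction.integrable ρ (star f * g))
  exact ⟨h _ inferInstance, h _ inferInstance⟩

/-- The total mass `‖μ‖ = μ⁺(ℝ^d) + μ⁻(ℝ^d)`. -/
def totalMass {d : ℕ} (μ : SignedMeasure (Space d)) : ℝ≥0∞ :=
  μ.totalVariation Set.univ

/-- Weak convergence of finite real-valued measures: convergence of the integrals of all bounded
continuous functions. -/
def WeaklyConverges {d : ℕ} (μ : ℕ → SignedMeasure (Space d)) (m : SignedMeasure (Space d)) :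
    Prop :=
  ∀ f : Space d →ᵇ ℝ,
    Tendsto (fun n => signedIntegral (μ n) f) atTop (𝓝 (signedIntegral m f))

/-! ### Operators associated to forms -/

section Operators

variable {H : Type*} [NormedAddCommGroup H] [InnerProductSpace ℂ H]

/-- The operator `A` associated to a sesquilinear form `a` with domain `D`: `f ∈ D` lies in the
domain of `A` and `A f = g` if and only if `a (h, f) = (h, g)` for all `h ∈ D`. (Forms and scalar
products are conjugate linear in the first argument. For dense `D` the vector `g` is unique.) -/
def associatedOperator (D : Submodule ℂ H) (a : D →ₗ⋆[ℂ] D →ₗ[ℂ] ℂ) : H →ₗ.[ℂ] H :=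
  Submodule.toLinearPMap
    { carrier := {p : H × H | ∃ f : D, (f : H) = p.1 ∧ ∀ h : D, a h f = inner ℂ (h : H) p.2}
      zero_mem' := ⟨0, by simp, by simp⟩
      add_mem' := by
        rintro p q ⟨f, hf, hf'⟩ ⟨g, hg, hg'⟩
        exact ⟨f + g, by simp [hf, hg], fun h => by simp [hf', hg']⟩
      smul_mem' := by
        rintro c p ⟨f, hf, hf'⟩
        exact ⟨c • f, by simp [hf], fun h => by simp [hf']⟩ }

/-- `A` is bounded from below. -/
def IsLowerSemibounded (A : H →ₗ.[ℂ] H) : Prop :=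
  ∃ γ : ℝ, ∀ f : A.domain, γ * ‖(f : H)‖ ^ 2 ≤ (inner ℂ (f : H) (A f)).re

/-- The bounded operator `R` is the resolvent `(A - z)⁻¹`. -/
def IsResolvent (A : H →ₗ.[ℂ] H) (z : ℂ) (R : H →L[ℂ] H) : Prop :=
  (∀ u : H, ∃ h : R u ∈ A.domain, A ⟨R u, h⟩ - z • R u = u) ∧
    ∀ f : A.domain, R (A f - z • (f : H)) = f

/-- Norm resolvent convergence `A n → B`: for all non-real `z` the resolvents `(A n - z)⁻¹` and
`(B - z)⁻¹` exist and `‖(A n - z)⁻¹ - (B - z)⁻¹‖ → 0`. -/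
def NormResolventConverges (A : ℕ → H →ₗ.[ℂ] H) (B : H →ₗ.[ℂ] H) : Prop :=
  ∀ z : ℂ, z.im ≠ 0 → ∃ (R : ℕ → H →L[ℂ] H) (S : H →L[ℂ] H),
    (∀ n, IsResolvent (A n) z (R n)) ∧ IsResolvent B z S ∧
      Tendsto (fun n => ‖R n - S‖) atTop (𝓝 0)

end Operators

/-! ### The Schrödinger operators -/

/-- The form `ε² (Δf, Δh) + (∇f, ∇h) + ∫ conj f̃ h̃ dμ` with domain `H²(ℝ^d)`, `d ≤ 3`. -/
def perturbedForm {d : ℕ} (hd : d ≤ 3) (ε : ℝ) (μ : SignedMeasure (Space d)) :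
    H2 d →ₗ⋆[ℂ] H2 d →ₗ[ℂ] ℂ :=
  LinearMap.mk₂'ₛₗ (starRingEnd ℂ) (RingHom.id ℂ)
    (fun f h => (ε : ℂ) ^ 2 * inner ℂ (laplacianH2 d f) (laplacianH2 d h)
      + ∑ j : Fin d, inner ℂ (partialH2 j f) (partialH2 j h)
      + signedIntegral μ (fun x => starRingEnd ℂ (contRep hd f x) * contRep hd h x))
    (by
      intro f f' h
      simp only [map_add, inner_add_left, Finset.sum_add_distrib, BoundedContinuousFunction.coe_add,
        Pi.add_apply, add_mul]
      rw [signedIntegral_add (integrable_rep μ _ _).1 (integrable_rep μ _ _).1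
        (integrable_rep μ _ _).2 (integrable_rep μ _ _).2]
      ring)
    (by
      intro c f h
      simp only [map_smul, inner_smul_left, BoundedContinuousFunction.coe_smul, smul_eq_mul,
        map_mul, mul_assoc, signedIntegral_const_mul, ← Finset.mul_sum]
      ring)
    (by
      intro f h h'
      simp only [map_add, inner_add_right, Finset.sum_add_distrib,
        BoundedContinuousFunction.coe_add, Pi.add_apply, mul_add]
      rw [signedIntegral_add (integrable_rep μ _ _).1 (integrable_rep μ _ _).1
        (integrable_rep μ _ _).2 (integrable_rep μ _ _).2]
      ring)
    (by
      intro c f h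
      simp only [map_smul, inner_smul_right, BoundedContinuousFunction.coe_smul, smul_eq_mul,
        mul_left_comm _ c, signedIntegral_const_mul, ← Finset.mul_sum, RingHom.id_apply]
      ring)

/-- The operator `-Δ + ε² Δ² + μ` in `L²(ℝ^d, dx)`, `d ≤ 3`. -/
def schrodinger {d : ℕ} (hd : d ≤ 3) (ε : ℝ) (μ : SignedMeasure (Space d)) : L2 d →ₗ.[ℂ] L2 d :=
  associatedOperator (H2 d) (perturbedForm hd ε μ)

/-! ### Green functions and the error terms -/

/-- The symbol `(ε² |p|⁴ + |p|² + α)⁻¹` with `p = 2πξ`. -/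
def greenSymbol (d : ℕ) (ε α : ℝ) (ξ : Space d) : ℂ :=
  (((ε ^ 2 * (2 * Real.pi * ‖ξ‖) ^ 4 + (2 * Real.pi * ‖ξ‖) ^ 2 + α)⁻¹ : ℝ) : ℂ)

open Classical in
/-- The function in `L²(ℝ^d, dx)` whose Fourier transform is the symbol above. (The symbol is
square integrable if `d ≤ 3` and `α > 0`.) -/
def greenL2 (d : ℕ) (ε α : ℝ) : L2 d :=
  if h : MemLp (greenSymbol d ε α) 2 volume then 𝓕⁻ (h.toLp (greenSymbol d ε α)) else 0

open Classical in
/-- The Green function `g_{ε,α}`, i.e. `(-Δ + ε² Δ² + α)⁻¹` is the convolution with `g_{ε,α}`. It is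
the continuous function if there is one (as for `ε > 0`); otherwise it is determined up to Lebesgue
null sets. -/
def green (d : ℕ) (ε α : ℝ) : Space d → ℂ :=
  if h : ∃ g : Space d → ℂ, Continuous g ∧ greenL2 d ε α =ᵐ[volume] g then h.choose
  else greenL2 d ε α

/-- `∫ |∫ g_{0,1}(y - a) g_{ε,α}(x - y) ν(dy)|² da`. -/
def errorDensity {d : ℕ} (ε α : ℝ) (ν : SignedMeasure (Space d)) (x : Space d) : ℝ≥0∞ :=
  ∫⁻ a, ‖signedIntegral ν (fun y => green d 0 1 (y - a) * green d ε α (x - y))‖ₑ ^ 2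

/-- `∫ ∫ |∫ g_{0,1}(y - a) g_{ε,α}(x - y) ν(dy)|² da dx`. -/
def errorTerm {d : ℕ} (ε α : ℝ) (ν : SignedMeasure (Space d)) : ℝ≥0∞ :=
  ∫⁻ x, errorDensity ε α ν x

/-- `∫ ∫ |∫ g_{0,1}(y - a) g_{ε,α}(x - y) ν(dy)|² da |m|(dx)`. -/
def errorTermOn {d : ℕ} (ε α : ℝ) (ν m : SignedMeasure (Space d)) : ℝ≥0∞ :=
  ∫⁻ x, errorDensity ε α ν x ∂m.totalVariation

end MeasurePerturbation

end

open MeasurePerturbation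

/-! Everything is transported to bounded operators. Let `s = ε²|p|⁴ + |p|² + α` be the symbol of the
free operator plus `α`, and let `L` (`resolventRoot`) be multiplication by `s^(-1/2)` followed by
the inverse Fourier transform. Since `s` is comparable to `(1 + |ξ|²)²`, `L` maps `L²` onto `H²`,
and the free form plus `α` becomes the scalar product of `L²`. For `d ≤ 3` the function `1/s` is
integrable, so evaluating the continuous representative of `L x` at a point is bounded in `x`, with
norm squared `∫ 1/s = g_{ε,α}(0)` (`greenMass`). Hence the measure term becomes a bounded
self-adjoint operator `B_μ` (`measureOp`) with norm at most `g_{ε,α}(0) ‖μ‖`. As `g_{ε,α}(0) → 0`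
for `α → ∞`, one threshold makes this at most `1/2` for `m` and all `μ_n`. Then `1 + B_μ` is
invertible, and `L (1 + B_μ)⁻¹ L*` is the resolvent at `-α` (`hasInverseGraph_schrodinger`);
self-adjointness and semiboundedness follow.

For the estimate let `ν = m - μ`, `y = (1 + B_μ)⁻¹ L* v`, `x = (1 + B_m)⁻¹ L* u`, and write `ỹ`,
`x̃` for the continuous representatives of `L y`, `L x`. The second resolvent identity expresses
`⟨v, (R_μ - R_m) u⟩` as `∫ conj ỹ x̃ dν` (`inner_perturbedResolvent_sub`). Inserting `x = L* u - B_m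
x`, that is, `x̃ = g * u - g * (x̃ m)` with `g = g_{ε,α}`, and applying Fubini moves the estimate to
`p(t) = ∫ ỹ(z) g(t - z) ν(dz)`, integrated against `u dt` and `x̃ dm`
(`conj_signedIntegral_evalMap`). In Fourier variables `p(t)` pairs `s^(-1/2) y` with the transform
of `g(t - ·) ν`. Because `s^(-1/2) ≤ const · (1 + |p|²)⁻¹`, and the right factor is the symbol of
`g_{0,1}`, Cauchy-Schwarz and Plancherel bound `|p(t)|²` by `‖y‖²` times the error density
(`enorm_pairing_sq_le`). Another Cauchy-Schwarz in `t`, for `dt` and for `|m|(dt)`, yields the two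
error terms.

By Plancherel the error terms are integrals of squared transforms of `g(t - ·) ν` or of `ν` against
integrable weights (`errorDensity_eq`, `lintegral_enorm_greenTransform_sq`). Weak convergence sends
these transforms to `0` pointwise, the bounded masses dominate them, and dominated convergence
finishes. Norm convergence at the single point `-α` extends to all non-real `z` by continuity of
inversion. -/

namespace MeasurePerturbation

/-! ### Unbounded operators described by a bounded resolvent, and form operators -/

section OperatorTheory

variable {H : Type*} [NormedAddCommGroup H] [InnerProductSpace ℂ H]

/-- The graph of `A` is described by the bounded operator `R`, as for `R = (A + α)⁻¹`. -/
def HasInverseGraph (A : H →ₗ.[ℂ] H) (α : ℝ) (R : H →L[ℂ] H) : Prop :=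
  ∀ p q : H, (p, q) ∈ A.graph ↔ p = R (q + (α : ℂ) • p)

/-- If `R u = 0`, then `(0, u)` satisfies the graph equation, and `A` is single-valued. -/
theorem HasInverseGraph.injective {A : H →ₗ.[ℂ] H} {α : ℝ} {R : H →L[ℂ] H}
    (h : HasInverseGraph A α R) {u : H} (hu : R u = 0) : u = 0 := by
  have h1 : ((0 : H), u) ∈ A.graph := by
    rw [h]; simp [hu]
  exact A.graph_fst_eq_zero_snd h1 rfl

theorem HasInverseGraph.mem_domain {A : H →ₗ.[ℂ] H} {α : ℝ} {R : H →L[ℂ] H}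
    (h : HasInverseGraph A α R) (u : H) :
    ∃ hu : R u ∈ A.domain, A ⟨R u, hu⟩ = u - (α : ℂ) • R u := by
  have h1 : (R u, u - (α : ℂ) • R u) ∈ A.graph := by
    rw [h]; simp
  obtain ⟨y, hy, hy'⟩ := (LinearPMap.mem_graph_iff A).1 h1
  have hu : R u ∈ A.domain := by
    have := y.2
    rwa [hy] at this
  exact ⟨hu, (congrArg A (Subtype.ext hy.symm)).trans hy'⟩

theorem HasInverseGraph.apply_add {A : H →ₗ.[ℂ] H} {α : ℝ} {R : H →L[ℂ] H}
    (h : HasInverseGraph A α R) (f : A.domain) : R (A f + (α : ℂ) • (f : H)) = f :=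
  ((h _ _).1 (A.mem_graph f)).symm

theorem HasInverseGraph.isResolvent {A : H →ₗ.[ℂ] H} {α : ℝ} {R : H →L[ℂ] H}
    (h : HasInverseGraph A α R) : IsResolvent A (-(α : ℂ)) R := by
  refine ⟨fun u => ?_, fun f => ?_⟩
  · obtain ⟨hu, hA⟩ := h.mem_domain u
    exact ⟨hu, by rw [hA]; simp⟩
  · rw [neg_smul, sub_neg_eq_add, h.apply_add]

variable [CompleteSpace H]

/-- The domain contains the range of `R`, whose orthogonal complement is the kernel of `R* = R`,
which is trivial. -/
theorem HasInverseGraph.dense_domain {A : H →ₗ.[ℂ] H} {α : ℝ} {R : H →L[ℂ] H}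
    (h : HasInverseGraph A α R) (hR : IsSelfAdjoint R) : Dense (A.domain : Set H) := by
  have h1 : R.range ≤ A.domain := by
    rintro _ ⟨u, rfl⟩
    exact (h.mem_domain u).1
  refine Dense.mono h1 ?_
  rw [Submodule.dense_iff_topologicalClosure_eq_top, Submodule.topologicalClosure_eq_top_iff,
    ContinuousLinearMap.orthogonal_range, hR.adjoint_eq, LinearMap.ker_eq_bot']
  exact fun u hu => h.injective hu

theorem HasInverseGraph.isSelfAdjoint {A : H →ₗ.[ℂ] H} {α : ℝ} {R : H →L[ℂ] H}
    (h : HasInverseGraph A α R) (hR : IsSelfAdjoint R) : IsSelfAdjoint A := by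
  have hs : ∀ x y, inner ℂ (R x) y = inner ℂ x (R y) := fun x y => by
    conv_lhs => rw [← hR.adjoint_eq]
    exact ContinuousLinearMap.adjoint_inner_left _ _ _
  rw [LinearPMap.isSelfAdjoint_def]
  apply LinearPMap.eq_of_eq_graph
  rw [LinearPMap.adjoint_graph_eq_graph_adjoint (h.dense_domain hR)]
  ext ⟨f, g⟩
  rw [Submodule.mem_adjoint_iff, h]
  -- The pairs `(R u, u - α R u)` exhaust the graph of `A`. Thus `(f, g)` lies in the graph of the
  -- adjoint exactly when the left side vanishes for all `u`, and the right side turns this into the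
  -- graph equation of `A` itself.
  have key : ∀ u, inner ℂ (u - (α : ℂ) • R u) f - inner ℂ (R u) g =
      inner ℂ u (f - R (g + (α : ℂ) • f)) := by
    intro u
    simp only [inner_sub_left, inner_sub_right, inner_smul_left, inner_smul_right, hs, map_add,
      map_smul, inner_add_right, Complex.conj_ofReal]
    ring
  constructor
  · intro hfg
    have : f - R (g + (α : ℂ) • f) = 0 := by
      refine ext_inner_left ℂ fun u => ?_
      rw [← key, inner_zero_right]
      exact hfg _ _ ((h _ _).2 (by simp))
    exact sub_eq_zero.1 this
  · intro hfg a b hab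
    rw [h] at hab
    have := key (b + (α : ℂ) • a)
    rw [← hab, sub_eq_zero.2 hfg, inner_zero_right] at this
    simpa using this

/-- The spectrum of `R` is real, so it misses `w⁻¹`; and `1 - w R = w (w⁻¹ - R)`. -/
theorem isUnit_one_sub_smul {R : H →L[ℂ] H} (hR : IsSelfAdjoint R) {w : ℂ} (hw : w.im ≠ 0) :
    IsUnit (1 - w • R) := by
  have hw0 : w ≠ 0 := fun h => hw (by simp [h])
  have h1 : w⁻¹ ∉ spectrum ℂ R := by
    intro hmem
    have h2 := congrArg Complex.im (hR.mem_spectrum_eq_re hmem)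
    rw [Complex.ofReal_im, Complex.inv_im] at h2
    have h3 : Complex.normSq w ≠ 0 := by simpa using hw0
    simp [hw, h3] at h2
  rw [spectrum.notMem_iff] at h1
  have h2 : 1 - w • R = (Units.mk0 w hw0) • (algebraMap ℂ (H →L[ℂ] H) w⁻¹ - R) := by
    rw [Units.smul_def, Units.val_mk0, smul_sub, Algebra.algebraMap_eq_smul_one, smul_smul,
      mul_inv_cancel₀ hw0, one_smul]
  rw [h2]
  exact h1.smul _

/-- On the domain `A - z = (1 - (z + α) R) (A + α)`, so inverting the two factors gives the
resolvent at `z`. -/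
theorem HasInverseGraph.isResolvent_of_im_ne_zero {A : H →ₗ.[ℂ] H} {α : ℝ} {R : H →L[ℂ] H}
    (h : HasInverseGraph A α R) (hR : IsSelfAdjoint R) {z : ℂ} (hz : z.im ≠ 0) :
    IsResolvent A z (R * Ring.inverse (1 - (z + α) • R)) := by
  have hu : IsUnit (1 - (z + α) • R) := isUnit_one_sub_smul hR (by simpa using hz)
  have h1 := Ring.mul_inverse_cancel _ hu
  have h2 := Ring.inverse_mul_cancel _ hu
  set V := Ring.inverse (1 - (z + α) • R) with hV
  refine ⟨fun u => ?_, fun f => ?_⟩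
  · obtain ⟨hd, hA⟩ := h.mem_domain (V u)
    refine ⟨hd, ?_⟩
    change A ⟨R (V u), hd⟩ - z • R (V u) = u
    rw [hA, sub_sub, ← add_smul]
    have := congrArg (fun T : H →L[ℂ] H => T u) h1
    simpa [add_comm, sub_mul, add_smul] using this
  · have h3 : A f - z • (f : H) = (1 - (z + α) • R) (A f + (α : ℂ) • (f : H)) := by
      rw [sub_apply, smul_apply, h.apply_add]
      simp [add_smul]
    rw [h3, mul_apply_eq_comp]
    have := congrArg (fun T : H →L[ℂ] H => R (T (A f + (α : ℂ) • (f : H)))) h2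
    simp only [mul_apply_eq_comp, one_apply_eq_self] at this
    rw [this, h.apply_add]

/-- The resolvent at `z` is a norm continuous function of the one at `-α`, because inversion is
continuous at units. -/
theorem normResolventConverges_of_tendsto {A : ℕ → H →ₗ.[ℂ] H} {B : H →ₗ.[ℂ] H} {α : ℝ}
    {R : ℕ → H →L[ℂ] H} {S : H →L[ℂ] H} (hA : ∀ n, HasInverseGraph (A n) α (R n))
    (hB : HasInverseGraph B α S) (hR : ∀ n, IsSelfAdjoint (R n)) (hS : IsSelfAdjoint S)
    (hlim : Tendsto R atTop (𝓝 S)) : NormResolventConverges A B := by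
  intro z hz
  refine ⟨_, _, fun n => (hA n).isResolvent_of_im_ne_zero (hR n) hz,
    hB.isResolvent_of_im_ne_zero hS hz, ?_⟩
  rw [← tendsto_iff_norm_sub_tendsto_zero]
  obtain ⟨U, hU⟩ := isUnit_one_sub_smul hS (w := z + α) (by simpa using hz)
  have h1 : Tendsto (fun n => 1 - (z + α) • R n) atTop (𝓝 (1 - (z + α) • S)) :=
    tendsto_const_nhds.sub (hlim.const_smul _)
  have h2 := NormedRing.inverse_continuousAt U
  rw [hU] at h2
  exact hlim.mul (h2.tendsto.comp h1)

variable {K : Type*} [NormedAddCommGroup K] [InnerProductSpace ℂ K] [CompleteSpace K]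

omit [CompleteSpace H] in
-- Density of `D` makes the defining relation single-valued; without it the graph of the partial map
-- need not be this relation.
theorem mem_graph_associatedOperator {D : Submodule ℂ H} {a : D →ₗ⋆[ℂ] D →ₗ[ℂ] ℂ}
    (hD : Dense (D : Set H)) {p q : H} : (p, q) ∈ (associatedOperator D a).graph ↔
      ∃ f : D, (f : H) = p ∧ ∀ h : D, a h f = inner ℂ (h : H) q := by
  unfold associatedOperator
  rw [Submodule.toLinearPMap_graph_eq]
  · rfl
  · rintro ⟨p, q⟩ ⟨f, hf, hfq⟩ hp
    simp only at hp hf hfq ⊢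
    have hf0 : f = 0 := Subtype.ext (hf.trans hp)
    refine hD.eq_zero_of_inner_right ℂ fun v hv => ?_
    rw [← hfq ⟨v, hv⟩, hf0, map_zero]

/-- Write `p = L x` and test with `h = L y`. The weak equation `a (h, p) + α ⟨h, p⟩ = ⟨h, q + α p⟩`
becomes `⟨y, T x⟩ = ⟨y, L* (q + α p)⟩` for all `y`, hence `x = T⁻¹ L* (q + α p)`. `L` need not be
injective. -/
theorem hasInverseGraph_associatedOperator {D : Submodule ℂ H} {a : D →ₗ⋆[ℂ] D →ₗ[ℂ] ℂ}
    (hD : Dense (D : Set H)) (L : K →L[ℂ] H) (hL : ∀ f, f ∈ D ↔ ∃ x, L x = f)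
    {T : K →L[ℂ] K} (hT : IsUnit T) {α : ℝ}
    (ha : ∀ (x y : K) (hx : L x ∈ D) (hy : L y ∈ D),
      a ⟨L y, hy⟩ ⟨L x, hx⟩ + α * inner ℂ (L y) (L x) = inner ℂ y (T x)) :
    HasInverseGraph (associatedOperator D a) α
      (L ∘L Ring.inverse T ∘L ContinuousLinearMap.adjoint L) := by
  have hT1 : ∀ x, T (Ring.inverse T x) = x := fun x =>
    congrArg (fun S : K →L[ℂ] K => S x) (Ring.mul_inverse_cancel _ hT)
  have hT2 : ∀ x, Ring.inverse T (T x) = x := fun x =>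
    congrArg (fun S : K →L[ℂ] K => S x) (Ring.inverse_mul_cancel _ hT)
  have hmem : ∀ x, L x ∈ D := fun x => (hL _).2 ⟨x, rfl⟩
  intro p q
  rw [mem_graph_associatedOperator hD]
  constructor
  · rintro ⟨⟨f, hf⟩, rfl, hfq⟩
    obtain ⟨x, rfl⟩ := (hL f).1 hf
    have : T x = ContinuousLinearMap.adjoint L (q + (α : ℂ) • L x) := by
      refine ext_inner_left ℂ fun y => ?_
      rw [← ha x y (hmem x) (hmem y), hfq ⟨L y, hmem y⟩,
        ContinuousLinearMap.adjoint_inner_right, inner_add_right, inner_smul_right]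
    simp only [ContinuousLinearMap.comp_apply]
    rw [← this, hT2]
  · intro hp
    set x := Ring.inverse T (ContinuousLinearMap.adjoint L (q + (α : ℂ) • p)) with hx
    have hp' : p = L x := hp
    refine ⟨⟨L x, hmem x⟩, hp'.symm, ?_⟩
    rintro ⟨h, hh⟩
    obtain ⟨y, rfl⟩ := (hL h).1 hh
    have h1 := ha x y (hmem x) (hmem y)
    have h2 : T x = ContinuousLinearMap.adjoint L (q + (α : ℂ) • p) := by rw [hx, hT1]
    rw [h2, ContinuousLinearMap.adjoint_inner_right, inner_add_right, inner_smul_right] at h1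
    have h3 : inner ℂ (L y) p = inner ℂ (L y) (L x) := by rw [← hp']
    rw [h3] at h1
    exact add_right_cancel h1

theorem isSelfAdjoint_comp_inverse (L : K →L[ℂ] H) {T : K →L[ℂ] K} (hT : IsSelfAdjoint T) :
    IsSelfAdjoint (L ∘L Ring.inverse T ∘L ContinuousLinearMap.adjoint L) := by
  have : IsSelfAdjoint (Ring.inverse T) := by
    rw [isSelfAdjoint_iff, ← Ring.inverse_star, hT.star_eq]
  exact this.conj_adjoint L

omit [CompleteSpace H] in
theorem isLowerSemibounded_associatedOperator {D : Submodule ℂ H} {a : D →ₗ⋆[ℂ] D →ₗ[ℂ] ℂ}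
    (hD : Dense (D : Set H)) {γ : ℝ} (ha : ∀ f : D, γ * ‖(f : H)‖ ^ 2 ≤ (a f f).re) :
    IsLowerSemibounded (associatedOperator D a) := by
  refine ⟨γ, fun f => ?_⟩
  obtain ⟨g, hg, hg'⟩ := (mem_graph_associatedOperator hD).1 (LinearPMap.mem_graph _ f)
  have h3 := ha g
  rwa [hg' g, hg] at h3

end OperatorTheory

end MeasurePerturbation

namespace MeasurePerturbation

/-! ### Integration against signed measures: bounds, linearity in the measure, Fubini -/

section SignedIntegral

variable {X Y : Type*} [MeasurableSpace X] [MeasurableSpace Y]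
  {E : Type*} [NormedAddCommGroup E] [NormedSpace ℝ E]

instance (μ : SignedMeasure X) : IsFiniteMeasure μ.totalVariation := by
  unfold SignedMeasure.totalVariation
  infer_instance

omit [NormedSpace ℝ E] in
theorem integrable_totalVariation_iff {μ : SignedMeasure X} {f : X → E} :
    Integrable f μ.totalVariation ↔ Integrable f μ.toJordanDecomposition.posPart ∧
      Integrable f μ.toJordanDecomposition.negPart :=
  integrable_add_measure

theorem enorm_signedIntegral_le (μ : SignedMeasure X) (f : X → E) :
    ‖signedIntegral μ f‖ₑ ≤ ∫⁻ x, ‖f x‖ₑ ∂μ.totalVariation := by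
  rw [SignedMeasure.totalVariation, lintegral_add_measure]
  refine enorm_sub_le.trans (add_le_add ?_ ?_) <;> exact enorm_integral_le_lintegral_enorm _

theorem norm_signedIntegral_le (μ : SignedMeasure X) {f : X → E} {C : ℝ}
    (hf : ∀ x, ‖f x‖ ≤ C) :
    ‖signedIntegral μ f‖ ≤ C * μ.totalVariation.real Set.univ := by
  have h : μ.totalVariation.real Set.univ = μ.toJordanDecomposition.posPart.real Set.univ +
      μ.toJordanDecomposition.negPart.real Set.univ := by
    rw [SignedMeasure.totalVariation, measureReal_add_apply]
  rw [h, mul_add]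
  refine (norm_sub_le _ _).trans (add_le_add ?_ ?_) <;>
  exact norm_integral_le_of_norm_le_const (Eventually.of_forall hf)

theorem signedIntegral_sub_fun {μ : SignedMeasure X} {f g : X → E}
    (hf : Integrable f μ.totalVariation) (hg : Integrable g μ.totalVariation) :
    signedIntegral μ (fun x => f x - g x) = signedIntegral μ f - signedIntegral μ g := by
  rw [integrable_totalVariation_iff] at hf hg
  simp only [signedIntegral]
  rw [integral_sub hf.1 hg.1, integral_sub hf.2 hg.2]
  abel

theorem signedIntegral_conj (μ : SignedMeasure X) (f : X → ℂ) :
    signedIntegral μ (fun x => starRingEnd ℂ (f x)) = starRingEnd ℂ (signedIntegral μ f) := by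
  simp only [signedIntegral, integral_conj, map_sub]

/-- The Jordan parts of `m - μ` are not the differences of those of `m` and `μ`. Only the rearranged
identity `key` between sums of positive measures holds, and it can be integrated term by term. -/
theorem signedIntegral_sub_measure (m μ : SignedMeasure X) {f : X → E}
    (h1 : Integrable f m.totalVariation) (h2 : Integrable f μ.totalVariation)
    (h3 : Integrable f (m - μ).totalVariation) :
    signedIntegral (m - μ) f = signedIntegral m f - signedIntegral μ f := by
  have key : (m - μ).toJordanDecomposition.posPart +
        (m.toJordanDecomposition.negPart + μ.toJordanDecomposition.posPart) =
      (m - μ).toJordanDecomposition.negPart +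
        (m.toJordanDecomposition.posPart + μ.toJordanDecomposition.negPart) := by
    ext s hs
    rw [← measureReal_eq_measureReal_iff]
    repeat rw [measureReal_add_apply]
    have e1 := (m - μ).apply_eq_posPart_real_sub_negPart_real hs
    have e2 := m.apply_eq_posPart_real_sub_negPart_real hs
    have e3 := μ.apply_eq_posPart_real_sub_negPart_real hs
    rw [sub_apply] at e1
    linarith
  rw [integrable_totalVariation_iff] at h1 h2 h3
  have h : ∫ x, f x ∂_ = ∫ x, f x ∂_ := congrArg (fun ρ => ∫ x, f x ∂ρ) key
  rw [integral_add_measure h3.1 (h1.2.add_measure h2.1), integral_add_measure h1.2 h2.1,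
    integral_add_measure h3.2 (h1.1.add_measure h2.2), integral_add_measure h1.1 h2.2] at h
  simp only [signedIntegral]
  rw [sub_eq_iff_eq_add, sub_sub_eq_add_sub]
  rw [← sub_eq_zero] at h ⊢
  rw [← h]
  abel

theorem signedIntegral_integral_swap {μ : SignedMeasure X} {ρ : Measure Y} [SFinite ρ]
    {f : X → Y → ℂ} (hf : Integrable (Function.uncurry f) (μ.totalVariation.prod ρ)) :
    signedIntegral μ (fun x => ∫ y, f x y ∂ρ) = ∫ y, signedIntegral μ (fun x => f x y) ∂ρ := by
  rw [SignedMeasure.totalVariation, Measure.add_prod, integrable_add_measure] at hf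
  simp only [signedIntegral]
  rw [integral_integral_swap hf.1, integral_integral_swap hf.2, integral_sub]
  · exact hf.1.integral_prod_right
  · exact hf.2.integral_prod_right

theorem integrable_signedIntegral {μ : SignedMeasure X} {ρ : Measure Y} [SFinite ρ]
    {f : X → Y → ℂ} (hf : Integrable (Function.uncurry f) (μ.totalVariation.prod ρ)) :
    Integrable (fun y => signedIntegral μ (fun x => f x y)) ρ := by
  rw [SignedMeasure.totalVariation, Measure.add_prod, integrable_add_measure] at hf
  exact hf.1.integral_prod_right.sub hf.2.integral_prod_right

theorem signedIntegral_signedIntegral_swap {μ : SignedMeasure X} {ν : SignedMeasure Y}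
    {f : X → Y → ℂ}
    (hf : Integrable (Function.uncurry f) (μ.totalVariation.prod ν.totalVariation)) :
    signedIntegral μ (fun x => signedIntegral ν (f x)) =
      signedIntegral ν (fun y => signedIntegral μ (fun x => f x y)) := by
  rw [show ν.totalVariation = ν.toJordanDecomposition.posPart + ν.toJordanDecomposition.negPart
    from rfl, Measure.prod_add, integrable_add_measure] at hf
  have h1 := signedIntegral_integral_swap hf.1
  have h2 := signedIntegral_integral_swap hf.2
  calc signedIntegral μ (fun x => signedIntegral ν (f x))
      = signedIntegral μ (fun x => ∫ y, f x y ∂ν.toJordanDecomposition.posPart) -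
        signedIntegral μ (fun x => ∫ y, f x y ∂ν.toJordanDecomposition.negPart) :=
        signedIntegral_sub_fun hf.1.integral_prod_left hf.2.integral_prod_left
    _ = _ := by rw [h1, h2]; rfl

theorem stronglyMeasurable_signedIntegral (μ : SignedMeasure X) {f : Y → X → ℂ}
    (hf : StronglyMeasurable (Function.uncurry f)) :
    StronglyMeasurable (fun y => signedIntegral μ (f y)) :=
  hf.integral_prod_right.sub hf.integral_prod_right

end SignedIntegral

/-! ### Weak convergence tested with complex functions -/

section Weak

variable {d : ℕ}

theorem integrable_boundedContinuous {X : Type*} [MeasurableSpace X] [TopologicalSpace X]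
    [OpensMeasurableSpace X]
    (μ : SignedMeasure X) (f : X →ᵇ ℂ) : Integrable f μ.totalVariation :=
  f.integrable _

theorem signedIntegral_re_add_im {X : Type*} [MeasurableSpace X] {μ : SignedMeasure X} {f : X → ℂ}
    (hf : Integrable f μ.totalVariation) :
    signedIntegral μ f = (signedIntegral μ (fun x => (f x).re) : ℝ) +
      (signedIntegral μ (fun x => (f x).im) : ℝ) * Complex.I := by
  rw [integrable_totalVariation_iff] at hf
  have h : ∀ ρ : Measure X, Integrable f ρ → ∫ x, f x ∂ρ =
      ((∫ x, (f x).re ∂ρ : ℝ) : ℂ) + ((∫ x, (f x).im ∂ρ : ℝ) : ℂ) * Complex.I :=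
    fun ρ hρ => (integral_re_add_im hρ).symm
  simp only [signedIntegral]
  rw [h _ hf.1, h _ hf.2]
  push_cast
  ring

theorem WeaklyConverges.tendsto_signedIntegral_sub {μ : ℕ → SignedMeasure (Space d)}
    {m : SignedMeasure (Space d)} (h : WeaklyConverges μ m) (f : Space d →ᵇ ℂ) :
    Tendsto (fun n => signedIntegral (m - μ n) f) atTop (𝓝 0) := by
  have hr : ∃ g : Space d →ᵇ ℝ, ∀ x, g x = (f x).re :=
    ⟨BoundedContinuousFunction.ofNormedAddCommGroup (fun x => (f x).re) (by fun_prop) ‖f‖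
      fun x => (Complex.abs_re_le_norm _).trans (f.norm_coe_le_norm x), fun x => rfl⟩
  have hi : ∃ g : Space d →ᵇ ℝ, ∀ x, g x = (f x).im :=
    ⟨BoundedContinuousFunction.ofNormedAddCommGroup (fun x => (f x).im) (by fun_prop) ‖f‖
      fun x => (Complex.abs_im_le_norm _).trans (f.norm_coe_le_norm x), fun x => rfl⟩
  obtain ⟨g, hg⟩ := hr
  obtain ⟨k, hk⟩ := hi
  have h1 : Tendsto (fun n => signedIntegral (μ n) f) atTop (𝓝 (signedIntegral m f)) := by
    have e : ∀ ν : SignedMeasure (Space d), signedIntegral ν f =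
        (signedIntegral ν g : ℝ) + (signedIntegral ν k : ℝ) * Complex.I := fun ν => by
      rw [signedIntegral_re_add_im (integrable_boundedContinuous ν f)]
      simp only [← hg, ← hk]
    simp only [e]
    exact ((Complex.continuous_ofReal.tendsto _).comp (h g)).add
      (((Complex.continuous_ofReal.tendsto _).comp (h k)).mul_const _)
  have h2 : ∀ n, signedIntegral (m - μ n) f = signedIntegral m f - signedIntegral (μ n) f :=
    fun n => signedIntegral_sub_measure _ _ (f.integrable _) (f.integrable _) (f.integrable _)
  simp only [h2]
  simpa using (tendsto_const_nhds (x := signedIntegral m f)).sub h1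

/-- The bound uses the masses of `m` and `μ` separately, since these are what is controlled
uniformly along the sequence. -/
theorem norm_signedIntegral_sub_le (m μ : SignedMeasure (Space d)) {f : Space d → ℂ} {C : ℝ}
    (hfm : Measurable f) (hf : ∀ x, ‖f x‖ ≤ C) : ‖signedIntegral (m - μ) f‖ ≤
      C * (m.totalVariation.real Set.univ + μ.totalVariation.real Set.univ) := by
  have hi : ∀ ν : SignedMeasure (Space d), Integrable f ν.totalVariation := fun ν =>
    Integrable.of_bound hfm.aestronglyMeasurable C (Eventually.of_forall hf)
  rw [signedIntegral_sub_measure _ _ (hi _) (hi _) (hi _), mul_add]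
  exact (norm_sub_le _ _).trans
    (add_le_add (norm_signedIntegral_le _ hf) (norm_signedIntegral_le _ hf))

end Weak

end MeasurePerturbation

namespace MeasurePerturbation

variable {d : ℕ}

/-! ### Plane waves and the Fourier transform -/

/-- The plane wave `exp (2πi ξ·x)`. -/
noncomputable def planeWave (ξ x : Space d) : ℂ :=
  ((Real.fourierChar (inner ℝ ξ x) : Circle) : ℂ)

@[simp]
theorem norm_planeWave (ξ x : Space d) : ‖planeWave ξ x‖ = 1 :=
  Circle.norm_coe _

theorem continuous_planeWave :
    Continuous fun p : Space d × Space d => planeWave p.1 p.2 := by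
  unfold planeWave
  exact continuous_subtype_val.comp (Real.continuous_fourierChar.comp continuous_inner)

@[fun_prop]
theorem Continuous.planeWave {X : Type*} [TopologicalSpace X] {f g : X → Space d}
    (hf : Continuous f) (hg : Continuous g) :
    Continuous fun x => MeasurePerturbation.planeWave (f x) (g x) :=
  continuous_planeWave.comp (hf.prodMk hg)

theorem planeWave_comm (ξ x : Space d) : planeWave ξ x = planeWave x ξ := by
  rw [planeWave, real_inner_comm, planeWave]

theorem planeWave_sub_right (ξ x y : Space d) :
    planeWave ξ (x - y) = planeWave ξ x * starRingEnd ℂ (planeWave ξ y) := by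
  rw [planeWave, inner_sub_right, sub_eq_add_neg, AddChar.map_add_eq_mul, Circle.coe_mul,
    AddChar.map_neg_eq_inv, Circle.coe_inv_eq_conj]
  rfl

theorem planeWave_sub_left (ξ x y : Space d) :
    planeWave (x - y) ξ = planeWave x ξ * starRingEnd ℂ (planeWave y ξ) := by
  rw [planeWave_comm, planeWave_sub_right, planeWave_comm ξ x, planeWave_comm ξ y]

theorem conj_planeWave (ξ x : Space d) :
    starRingEnd ℂ (planeWave ξ x) = planeWave ξ (-x) := by
  rw [planeWave, planeWave, inner_neg_right, AddChar.map_neg_eq_inv, Circle.coe_inv_eq_conj]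

theorem fourierInv_eq_planeWave (f : Space d → ℂ) (x : Space d) :
    𝓕⁻ f x = ∫ ξ, planeWave ξ x * f ξ := by
  simp only [Real.fourierInv_eq, planeWave, Circle.smul_def, smul_eq_mul]

theorem fourier_eq_planeWave (f : Space d → ℂ) (x : Space d) :
    𝓕 f x = ∫ ξ, starRingEnd ℂ (planeWave ξ x) * f ξ := by
  rw [Real.fourier_eq]
  refine integral_congr_ae (Eventually.of_forall fun ξ => ?_)
  simp only [conj_planeWave]
  rw [planeWave, inner_neg_right, Circle.smul_def, smul_eq_mul]

theorem continuous_fourierInv {w : Space d → ℂ} (hw : Integrable w) : Continuous (𝓕⁻ w) := by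
  have hL : Continuous fun p : Space d × Space d => (-innerₗ (Space d)) p.1 p.2 := by
    simp only [LinearMap.neg_apply, innerₗ_apply_apply]
    fun_prop
  exact VectorFourier.fourierIntegral_continuous Real.continuous_fourierChar hL hw

theorem norm_fourierInv_le (w : Space d → ℂ) (x : Space d) : ‖𝓕⁻ w x‖ ≤ ∫ ξ, ‖w ξ‖ :=
  VectorFourier.norm_fourierIntegral_le_integral_norm _ _ _ _ x

/-- Locally integrable functions that agree as distributions agree almost everywhere. -/
theorem ae_eq_of_forall_integral_schwartz_mul_eq {f g : Space d → ℂ}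
    (hf : LocallyIntegrable f) (hg : LocallyIntegrable g)
    (h : ∀ φ : 𝓢(Space d, ℂ), HasCompactSupport φ → ∫ x, φ x * f x = ∫ x, φ x * g x) :
    f =ᵐ[volume] g := by
  refine ae_eq_of_integral_contDiff_smul_eq hf hg fun u hu huc => ?_
  have hu1 : HasCompactSupport (Complex.ofRealCLM ∘ u) := huc.comp_left rfl
  have hu2 : ContDiff ℝ (⊤ : ℕ∞) (Complex.ofRealCLM ∘ u) := by fun_prop
  have := h (hu1.toSchwartzMap hu2) hu1
  simpa using this

theorem L2.locallyIntegrable (f : L2 d) : LocallyIntegrable f :=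
  (Lp.memLp f).locallyIntegrable (by norm_num)

theorem L2.integral_schwartz_mul_fourierInv (w : L2 d) (φ : 𝓢(Space d, ℂ)) :
    ∫ x, φ x * (𝓕⁻ w : L2 d) x = ∫ ξ, 𝓕⁻ (φ : Space d → ℂ) ξ * w ξ := by
  have h1 : ((𝓕⁻ w : L2 d) : 𝓢'(Space d, ℂ)) φ = ∫ x, φ x * (𝓕⁻ w : L2 d) x := by simp
  rw [← h1, ← Lp.fourierInv_toTemperedDistribution_eq, TemperedDistribution.fourierInv_apply,
    Lp.toTemperedDistribution_apply, SchwartzMap.fourierInv_coe]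
  rfl

theorem L2.integral_schwartz_mul_fourier (w : L2 d) (φ : 𝓢(Space d, ℂ)) :
    ∫ x, φ x * (𝓕 w : L2 d) x = ∫ ξ, 𝓕 (φ : Space d → ℂ) ξ * w ξ := by
  have h1 : ((𝓕 w : L2 d) : 𝓢'(Space d, ℂ)) φ = ∫ x, φ x * (𝓕 w : L2 d) x := by simp
  rw [← h1, ← Lp.fourier_toTemperedDistribution_eq, TemperedDistribution.fourier_apply,
    Lp.toTemperedDistribution_apply, SchwartzMap.fourier_coe]
  rfl

/-- On `L¹ ∩ L²` the inverse Fourier transform is given by the integral. -/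
theorem L2.fourierInv_ae_eq (w : L2 d) (hw : Integrable w) :
    (𝓕⁻ w : L2 d) =ᵐ[volume] 𝓕⁻ (w : Space d → ℂ) := by
  refine ae_eq_of_forall_integral_schwartz_mul_eq (L2.locallyIntegrable _)
    (continuous_fourierInv hw).locallyIntegrable fun φ _ => ?_
  rw [L2.integral_schwartz_mul_fourierInv]
  have hL : Continuous fun p : Space d × Space d => (-innerₗ (Space d)) p.1 p.2 := by
    simp only [LinearMap.neg_apply, innerₗ_apply_apply]
    fun_prop
  have hφi : Integrable (φ : Space d → ℂ) := φ.integrable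
  have h := VectorFourier.integral_fourierIntegral_smul_eq_flip
    Real.continuous_fourierChar hL hφi hw
  have hflip : (-innerₗ (Space d)).flip = -innerₗ (Space d) := by
    ext x y
    simp [real_inner_comm]
  rw [hflip] at h
  exact h

/-- Turns identities of distributional Fourier multipliers into pointwise identities of `L²`
functions, on which the form computations rely. -/
theorem L2.ae_eq_mul_of_smulLeftCLM_eq {w : Space d → ℂ} (hw : w.HasTemperateGrowth) {f h : L2 d}
    (hfh : TemperedDistribution.smulLeftCLM ℂ w (f : 𝓢'(Space d, ℂ)) = h) :
    h =ᵐ[volume] fun ξ => w ξ * f ξ := by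
  refine ae_eq_of_forall_integral_schwartz_mul_eq (L2.locallyIntegrable _)
    ?_ fun φ _ => ?_
  · rw [locallyIntegrable_iff]
    intro k hk
    exact ((L2.locallyIntegrable f).integrableOn_isCompact hk).continuousOn_mul
      hw.1.continuous.continuousOn hk
  · have h1 : (Lp.toTemperedDistribution h : 𝓢'(Space d, ℂ)) φ = ∫ x, φ x * h x := by simp
    rw [← h1, ← hfh, TemperedDistribution.smulLeftCLM_apply_apply, Lp.toTemperedDistribution_apply]
    refine integral_congr_ae (Eventually.of_forall fun x => ?_)
    simp only [SchwartzMap.smulLeftCLM_apply_apply hw, smul_eq_mul]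
    ring

theorem L2.smulLeftCLM_eq {w : Space d → ℂ} (hw : w.HasTemperateGrowth) {f h : L2 d}
    (hfh : h =ᵐ[volume] fun ξ => w ξ * f ξ) :
    TemperedDistribution.smulLeftCLM ℂ w (f : 𝓢'(Space d, ℂ)) = h := by
  ext φ
  rw [TemperedDistribution.smulLeftCLM_apply_apply, Lp.toTemperedDistribution_apply,
    Lp.toTemperedDistribution_apply]
  refine integral_congr_ae (hfh.mono fun x hx => ?_)
  simp only [SchwartzMap.smulLeftCLM_apply_apply hw, smul_eq_mul, hx]
  ring

theorem L2.lintegral_enorm_sq (f : L2 d) : ∫⁻ x, ‖f x‖ₑ ^ 2 = ‖f‖ₑ ^ 2 := by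
  rw [Lp.enorm_def, eLpNorm_eq_lintegral_rpow_enorm_toReal (by norm_num) (by norm_num),
    ← ENNReal.rpow_natCast, ← ENNReal.rpow_mul]
  simp

/-! ### Convolutions of square integrable functions with measures -/

/-- The integral over `a` is bounded uniformly in `y`, by `|k||g| ≤ |k|² + |g|²` and translation
invariance, and `ρ` is finite. This justifies the applications of Fubini to convolutions of `L²`
functions with measures. -/
theorem integrable_mul_comp_sub_mul {ρ : Measure (Space d)} [IsFiniteMeasure ρ]
    {k g h : Space d → ℂ} (hk : MemLp k 2) (hkm : StronglyMeasurable k)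
    (hg : MemLp g 2) (hgm : StronglyMeasurable g) (hh : StronglyMeasurable h) {C : ℝ}
    (hC : ∀ y, ‖h y‖ ≤ C) :
    Integrable (Function.uncurry fun y a => k a * (g (y - a) * h y)) (ρ.prod volume) := by
  have hm : StronglyMeasurable (Function.uncurry fun y a : Space d => k a * (g (y - a) * h y)) :=
    (hkm.comp_measurable measurable_snd).mul
      ((hgm.comp_measurable (measurable_fst.sub measurable_snd)).mul
        (hh.comp_measurable measurable_fst))
  have hg' : ∀ y, MemLp (fun a => g (y - a)) 2 volume := fun y =>
    hg.comp_measurePreserving (Measure.measurePreserving_sub_left volume y)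
  have hk2 : Integrable (fun a => ‖k a‖ ^ 2) := hk.integrable_norm_pow (by norm_num)
  have hg2 : Integrable (fun a => ‖g a‖ ^ 2) := hg.integrable_norm_pow (by norm_num)
  have hi : ∀ y, Integrable (fun a => k a * (g (y - a) * h y)) := fun y => by
    simp only [← mul_assoc]
    exact (hk.integrable_mul (hg' y)).mul_const _
  have hC0 : 0 ≤ C := (norm_nonneg _).trans (hC 0)
  rw [integrable_prod_iff hm.aestronglyMeasurable]
  refine ⟨Eventually.of_forall hi, ?_⟩
  refine Integrable.of_bound (C := C * ((∫ a, ‖k a‖ ^ 2) + ∫ a, ‖g a‖ ^ 2))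
    hm.norm.integral_prod_right'.aestronglyMeasurable (Eventually.of_forall fun y => ?_)
  have hy2 : Integrable (fun a => ‖g (y - a)‖ ^ 2) := (hg' y).integrable_norm_pow (by norm_num)
  have e : ∫ a, ‖g (y - a)‖ ^ 2 = ∫ a, ‖g a‖ ^ 2 :=
    integral_sub_left_eq_self (fun a => ‖g a‖ ^ 2) volume y
  rw [Real.norm_of_nonneg (integral_nonneg fun _ => norm_nonneg _), ← e,
    ← integral_add hk2 hy2, ← integral_const_mul]
  refine integral_mono (hi y).norm ((hk2.add hy2).const_mul C) fun a => ?_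
  simp only [Function.uncurry, norm_mul]
  calc ‖k a‖ * (‖g (y - a)‖ * ‖h y‖) ≤ ‖k a‖ * (‖g (y - a)‖ * C) := by gcongr; exact hC y
    _ = C * (‖k a‖ * ‖g (y - a)‖) := by ring
    _ ≤ C * (‖k a‖ ^ 2 + ‖g (y - a)‖ ^ 2) := by
      gcongr
      nlinarith [sq_nonneg (‖k a‖ - ‖g (y - a)‖), sq_nonneg ‖k a‖, sq_nonneg ‖g (y - a)‖]

/-- The reflection turns the inverse transform into the forward one, and the translation produces
the plane wave. -/
theorem fourierInv_comp_sub (φ : Space d → ℂ) (y ξ : Space d) :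
    𝓕⁻ (fun b => φ (y - b)) ξ = planeWave ξ y * 𝓕 φ ξ := by
  rw [fourierInv_eq_planeWave, fourier_eq_planeWave, ← integral_const_mul,
    ← integral_sub_left_eq_self _ volume y]
  refine integral_congr_ae (Eventually.of_forall fun b => ?_)
  simp only [sub_sub_cancel, planeWave_sub_left, planeWave_comm ξ y]
  ring

/-- The convolution of a square integrable function with a measure, in the Fourier picture. -/
theorem lintegral_enorm_signedIntegral_sq {w : L2 d} {g h : Space d → ℂ}
    (hgm : StronglyMeasurable g) (hg : (𝓕⁻ w : L2 d) =ᵐ[volume] g)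
    (hh : StronglyMeasurable h) {C : ℝ} (hC : ∀ y, ‖h y‖ ≤ C) (ν : SignedMeasure (Space d)) :
    ∫⁻ a, ‖signedIntegral ν (fun y => g (y - a) * h y)‖ₑ ^ 2 =
      ∫⁻ ξ, ‖w ξ‖ₑ ^ 2 * ‖signedIntegral ν (fun y => planeWave ξ y * h y)‖ₑ ^ 2 := by
  have hg2 : MemLp g 2 := (Lp.memLp (𝓕⁻ w : L2 d)).ae_eq hg
  set T : Space d → ℂ := fun a => signedIntegral ν (fun y => g (y - a) * h y) with hT
  set P : Space d → ℂ := fun ξ => signedIntegral ν (fun y => planeWave ξ y * h y) with hP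
  have hPm : StronglyMeasurable P := by
    refine stronglyMeasurable_signedIntegral ν (StronglyMeasurable.mul ?_ ?_)
    · exact continuous_planeWave.stronglyMeasurable
    · exact hh.comp_measurable measurable_snd
  have hPb : ∀ ξ, ‖P ξ‖ ≤ C * ν.totalVariation.real Set.univ := fun ξ =>
    norm_signedIntegral_le ν fun y => by simpa using hC y
  have hW : MemLp (fun ξ => P ξ * w ξ) 2 volume := by
    refine (Lp.memLp w).of_le_mul (c := C * ν.totalVariation.real Set.univ)
      (hPm.aestronglyMeasurable.mul (Lp.aestronglyMeasurable w)) (Eventually.of_forall fun ξ => ?_)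
    rw [norm_mul]
    gcongr
    exact hPb ξ
  have hTm : StronglyMeasurable T := by
    refine stronglyMeasurable_signedIntegral ν (StronglyMeasurable.mul ?_ ?_)
    · exact hgm.comp_measurable (measurable_snd.sub measurable_fst)
    · exact hh.comp_measurable measurable_snd
  have hkT : ∀ k : Space d → ℂ, ∀ a, signedIntegral ν (fun y => k a * (g (y - a) * h y)) =
      k a * T a := fun k a => signedIntegral_const_mul ν _ _
  -- Over a compact set, integrability comes from Fubini with the indicator function in the role of
  -- `k`.
  have hTl : LocallyIntegrable T := by
    rw [locallyIntegrable_iff]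
    intro s hs
    have hk : MemLp (s.indicator (1 : Space d → ℂ)) 2 volume :=
      memLp_indicator_const 2 hs.measurableSet (1 : ℂ) (Or.inr hs.measure_lt_top.ne)
    have hi := integrable_signedIntegral (integrable_mul_comp_sub_mul (ρ := ν.totalVariation) hk
      (stronglyMeasurable_one.indicator hs.measurableSet) hg2 hgm hh hC)
    simp only [hkT] at hi
    rw [← integrable_indicator_iff hs.measurableSet]
    refine hi.congr (Eventually.of_forall fun a => ?_)
    by_cases ha : a ∈ s <;> simp [ha]
  -- The convolution is the Fourier transform of `P * w`. The forward transform appears because the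
  -- argument of `g` is `y - a`. Testing with compactly supported smooth functions avoids assuming
  -- that `w` is integrable.
  have key : T =ᵐ[volume] (𝓕 (hW.toLp _) : L2 d) := by
    refine ae_eq_of_forall_integral_schwartz_mul_eq hTl (L2.locallyIntegrable _) fun φ hφ => ?_
    have hF := integrable_mul_comp_sub_mul (ρ := ν.totalVariation) (φ.memLp 2 volume)
      φ.continuous.stronglyMeasurable hg2 hgm hh hC
    have h1 := signedIntegral_integral_swap hF
    simp only [hkT] at h1
    have hinner : ∀ y, ∫ a, φ a * (g (y - a) * h y) =
        ∫ ξ, (𝓕 (φ : Space d → ℂ) ξ * w ξ) * (planeWave ξ y * h y) := by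
      intro y
      -- Compact support of `φ` lets the reflected translate be repackaged as a Schwartz function.
      have hc : HasCompactSupport fun b => φ (y - b) :=
        hφ.comp_homeomorph (Homeomorph.subLeft y)
      have hs : ContDiff ℝ (⊤ : ℕ∞) fun b => φ (y - b) := (φ.smooth _).comp (by fun_prop)
      have h2 := L2.integral_schwartz_mul_fourierInv w (hc.toSchwartzMap hs)
      have h3 : ((hc.toSchwartzMap hs : 𝓢(Space d, ℂ)) : Space d → ℂ) = fun b => φ (y - b) := rfl
      rw [h3] at h2
      simp only [fourierInv_comp_sub] at h2
      calc ∫ a, φ a * (g (y - a) * h y) = (∫ a, φ (y - a) * g a) * h y := by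
            rw [← integral_mul_const, ← integral_sub_left_eq_self _ volume y]
            simp only [sub_sub_cancel, mul_assoc]
        _ = (∫ a, φ (y - a) * (𝓕⁻ w : L2 d) a) * h y := by
            congr 1
            refine integral_congr_ae (hg.mono fun a ha => ?_)
            simp only [ha]
        _ = _ := by
            rw [h2, ← integral_mul_const]
            refine integral_congr_ae (Eventually.of_forall fun a => ?_)
            simp only
            ring
    simp only [hinner] at h1
    rw [← h1, L2.integral_schwartz_mul_fourier, signedIntegral_integral_swap]
    · simp only [signedIntegral_const_mul]
      refine integral_congr_ae ((hW.coeFn_toLp).mono fun ξ hξ => ?_)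
      beta_reduce
      rw [hξ]
      ring
    · have hi : Integrable (fun ξ => 𝓕 (φ : Space d → ℂ) ξ * w ξ) := by
        rw [← SchwartzMap.fourier_coe]
        exact ((𝓕 φ).memLp 2 volume).integrable_mul (Lp.memLp w)
      refine (hi.comp_snd ν.totalVariation).mul_bdd (c := C) ?_ (Eventually.of_forall fun p => ?_)
      · refine StronglyMeasurable.aestronglyMeasurable (StronglyMeasurable.mul ?_ ?_)
        · exact Continuous.stronglyMeasurable (by fun_prop)
        · exact hh.comp_measurable measurable_fst
      · simpa using hC p.1
  calc ∫⁻ a, ‖T a‖ₑ ^ 2 = ∫⁻ a, ‖(𝓕 (hW.toLp _) : L2 d) a‖ₑ ^ 2 :=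
        lintegral_congr_ae (key.mono fun a ha => by simp only [ha])
    _ = ∫⁻ a, ‖(hW.toLp _ : L2 d) a‖ₑ ^ 2 := by
        rw [L2.lintegral_enorm_sq, L2.lintegral_enorm_sq]
        congr 1
        rw [← ofReal_norm, ← ofReal_norm, Lp.norm_fourier_eq]
    _ = _ := by
        refine lintegral_congr_ae ((hW.coeFn_toLp).mono fun ξ hξ => ?_)
        beta_reduce
        rw [hξ, enorm_mul, mul_pow, mul_comm]

end MeasurePerturbation

namespace MeasurePerturbation

variable {d : ℕ}

/-! ### The symbol and its square root -/

/-- The symbol `ε² |p|⁴ + |p|² + α` with `p = 2πξ`. -/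
noncomputable def symbol (ε α : ℝ) (ξ : Space d) : ℝ :=
  ε ^ 2 * (2 * Real.pi * ‖ξ‖) ^ 4 + (2 * Real.pi * ‖ξ‖) ^ 2 + α

theorem greenSymbol_eq (ε α : ℝ) (ξ : Space d) :
    greenSymbol d ε α ξ = ((symbol ε α ξ)⁻¹ : ℝ) := rfl

theorem continuous_symbol (ε α : ℝ) : Continuous (symbol (d := d) ε α) := by
  unfold symbol
  fun_prop

theorem le_symbol (ε α : ℝ) (ξ : Space d) : α ≤ symbol ε α ξ := by
  unfold symbol
  nlinarith [mul_nonneg (sq_nonneg ε) (sq_nonneg ((2 * Real.pi * ‖ξ‖) ^ 2)),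
    sq_nonneg (2 * Real.pi * ‖ξ‖)]

theorem symbol_pos (ε : ℝ) {α : ℝ} (hα : 0 < α) (ξ : Space d) : 0 < symbol ε α ξ :=
  hα.trans_le (le_symbol ε α ξ)

theorem continuous_greenSymbol (ε : ℝ) {α : ℝ} (hα : 0 < α) : Continuous (greenSymbol d ε α) := by
  simp only [funext (greenSymbol_eq (d := d) ε α)]
  exact Complex.continuous_ofReal.comp
    ((continuous_symbol ε α).inv₀ fun ξ => (symbol_pos ε hα ξ).ne')

/-- A constant bounding `(1 + |p|²)²` by the symbol. -/
noncomputable def symbolConst (ε α : ℝ) : ℝ := 2 / α + 2 / ε ^ 2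

theorem symbolConst_pos {ε α : ℝ} (hε : 0 < ε) (hα : 0 < α) : 0 < symbolConst ε α := by
  unfold symbolConst; positivity

/-- From `(1 + p²)² ≤ 2 + 2 p⁴`: the constant `2` is `(2/α) · α`, the quartic part is `(2/ε²) · ε²
p⁴`, and the other products are nonnegative. The quartic term with `ε > 0` is essential here. -/
theorem sq_one_add_le_symbol {ε α : ℝ} (hε : 0 < ε) (hα : 0 < α) (ξ : Space d) :
    (1 + (2 * Real.pi * ‖ξ‖) ^ 2) ^ 2 ≤ symbolConst ε α * symbol ε α ξ := by
  unfold symbolConst symbol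
  set p := 2 * Real.pi * ‖ξ‖
  have h1 : (2 / α + 2 / ε ^ 2) * (ε ^ 2 * p ^ 4 + p ^ 2 + α) =
      2 + 2 * p ^ 4 + (2 / α * (ε ^ 2 * p ^ 4 + p ^ 2) + 2 / ε ^ 2 * (p ^ 2 + α)) := by
    field_simp
    ring
  rw [h1]
  have h2 : 0 ≤ 2 / α * (ε ^ 2 * p ^ 4 + p ^ 2) + 2 / ε ^ 2 * (p ^ 2 + α) := by positivity
  nlinarith [sq_nonneg (p ^ 2 - 1)]

theorem norm_sq_le_momentum_sq (ξ : Space d) : ‖ξ‖ ^ 2 ≤ (2 * Real.pi * ‖ξ‖) ^ 2 := by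
  have h1 : ‖ξ‖ ≤ 2 * Real.pi * ‖ξ‖ := by
    nlinarith [Real.pi_gt_three, norm_nonneg ξ]
  gcongr

theorem sq_one_add_norm_sq_le_symbol {ε α : ℝ} (hε : 0 < ε) (hα : 0 < α) (ξ : Space d) :
    (1 + ‖ξ‖ ^ 2) ^ 2 ≤ symbolConst ε α * symbol ε α ξ := by
  refine le_trans ?_ (sq_one_add_le_symbol hε hα ξ)
  have := norm_sq_le_momentum_sq ξ
  gcongr

theorem symbol_le (ε : ℝ) {α : ℝ} (hα : 0 < α) (ξ : Space d) :
    symbol ε α ξ ≤ (ε ^ 2 * (2 * Real.pi) ^ 4 + (2 * Real.pi) ^ 2 + α) * (1 + ‖ξ‖ ^ 2) ^ 2 := by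
  unfold symbol
  have h0 := sq_nonneg ‖ξ‖
  have h1 : ‖ξ‖ ^ 4 ≤ (1 + ‖ξ‖ ^ 2) ^ 2 := by nlinarith
  have h2 : ‖ξ‖ ^ 2 ≤ (1 + ‖ξ‖ ^ 2) ^ 2 := by nlinarith
  have h3 : 1 ≤ (1 + ‖ξ‖ ^ 2) ^ 2 := by nlinarith
  calc ε ^ 2 * (2 * Real.pi * ‖ξ‖) ^ 4 + (2 * Real.pi * ‖ξ‖) ^ 2 + α
      = ε ^ 2 * (2 * Real.pi) ^ 4 * ‖ξ‖ ^ 4 + (2 * Real.pi) ^ 2 * ‖ξ‖ ^ 2 + α * 1 := by ring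
    _ ≤ ε ^ 2 * (2 * Real.pi) ^ 4 * (1 + ‖ξ‖ ^ 2) ^ 2 +
        (2 * Real.pi) ^ 2 * (1 + ‖ξ‖ ^ 2) ^ 2 + α * (1 + ‖ξ‖ ^ 2) ^ 2 := by gcongr
    _ = _ := by ring

/-- The decay is of order `|ξ|⁻⁴`, and `d < 4`. -/
theorem integrable_inv_sq_one_add_norm_sq (hd : d ≤ 3) :
    Integrable (fun ξ : Space d => ((1 + ‖ξ‖ ^ 2) ^ 2)⁻¹) := by
  have h : (Module.finrank ℝ (Space d) : ℝ) < 4 := by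
    rw [finrank_euclideanSpace_fin]
    exact_mod_cast Nat.lt_succ_of_le hd
  refine (integrable_rpow_neg_one_add_norm_sq (μ := volume) h).congr
    (Eventually.of_forall fun ξ => ?_)
  beta_reduce
  rw [show (-4 / 2 : ℝ) = -((2 : ℕ) : ℝ) by norm_num, Real.rpow_neg (by positivity),
    Real.rpow_natCast]

theorem integrable_inv_symbol (hd : d ≤ 3) {ε α : ℝ} (hε : 0 < ε) (hα : 0 < α) :
    Integrable (fun ξ : Space d => (symbol ε α ξ)⁻¹) := by
  refine ((integrable_inv_sq_one_add_norm_sq hd).const_mul (symbolConst ε α)).mono'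
    ((continuous_symbol ε α).inv₀ fun ξ => (symbol_pos ε hα ξ).ne').aestronglyMeasurable
    (Eventually.of_forall fun ξ => ?_)
  have h1 := symbol_pos ε hα ξ
  rw [Real.norm_of_nonneg (by positivity), ← div_eq_mul_inv, le_div_iff₀ (by positivity),
    inv_mul_le_iff₀ h1, mul_comm]
  exact sq_one_add_norm_sq_le_symbol hε hα ξ

theorem integrable_greenSymbol (hd : d ≤ 3) {ε α : ℝ} (hε : 0 < ε) (hα : 0 < α) :
    Integrable (greenSymbol d ε α) :=
  (integrable_inv_symbol hd hε hα).ofReal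

theorem norm_greenSymbol (ε : ℝ) {α : ℝ} (hα : 0 < α) (ξ : Space d) :
    ‖greenSymbol d ε α ξ‖ = (symbol ε α ξ)⁻¹ := by
  have := symbol_pos ε hα ξ
  rw [greenSymbol_eq, Complex.norm_real, Real.norm_of_nonneg (by positivity)]

/-- Here `ε = 0` is allowed, as `g_{0,1}` requires: the term `|p|² + α` alone gives decay `(1 +
|ξ|²)⁻¹`, which is square integrable for `d ≤ 3`. -/
theorem memLp_greenSymbol (hd : d ≤ 3) (ε : ℝ) {α : ℝ} (hα : 0 < α) :
    MemLp (greenSymbol d ε α) 2 volume := by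
  have hm := (continuous_greenSymbol (d := d) ε hα).aestronglyMeasurable (μ := volume)
  rw [memLp_two_iff_integrable_sq_norm hm]
  refine ((integrable_inv_sq_one_add_norm_sq hd).const_mul ((1 / α + 1) ^ 2)).mono'
    (hm.norm.pow 2) (Eventually.of_forall fun ξ => ?_)
  have h1 := symbol_pos ε hα ξ
  rw [norm_greenSymbol ε hα, Real.norm_of_nonneg (by positivity), ← inv_pow,
    ← mul_pow]
  gcongr
  rw [← div_eq_mul_inv, le_div_iff₀ (by positivity), inv_mul_le_iff₀ h1, mul_comm]
  have h2 : 1 + ‖ξ‖ ^ 2 ≤ (1 / α + 1) * (‖ξ‖ ^ 2 + α) := by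
    have : (1 / α + 1) * (‖ξ‖ ^ 2 + α) = 1 + ‖ξ‖ ^ 2 + (‖ξ‖ ^ 2 / α + α) := by
      field_simp
      ring
    rw [this]
    have : 0 ≤ ‖ξ‖ ^ 2 / α + α := by positivity
    linarith
  refine h2.trans ?_
  gcongr
  unfold symbol
  have := norm_sq_le_momentum_sq ξ
  have h3 : 0 ≤ ε ^ 2 * (2 * Real.pi * ‖ξ‖) ^ 4 := by positivity
  linarith

/-- The square root of the Green symbol. -/
noncomputable def rootSymbol (ε α : ℝ) (ξ : Space d) : ℂ := ((√(symbol ε α ξ))⁻¹ : ℝ)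

theorem continuous_rootSymbol (ε : ℝ) {α : ℝ} (hα : 0 < α) :
    Continuous (rootSymbol (d := d) ε α) :=
  Complex.continuous_ofReal.comp ((Real.continuous_sqrt.comp (continuous_symbol ε α)).inv₀
    fun ξ => (Real.sqrt_pos.2 (symbol_pos ε hα ξ)).ne')

theorem norm_rootSymbol (ε α : ℝ) (ξ : Space d) :
    ‖rootSymbol ε α ξ‖ = (√(symbol ε α ξ))⁻¹ := by
  rw [rootSymbol, Complex.norm_real, Real.norm_of_nonneg (by positivity)]

theorem rootSymbol_ne_zero (ε : ℝ) {α : ℝ} (hα : 0 < α) (ξ : Space d) :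
    rootSymbol ε α ξ ≠ 0 := by
  rw [← norm_ne_zero_iff, norm_rootSymbol]
  exact inv_ne_zero (Real.sqrt_pos.2 (symbol_pos ε hα ξ)).ne'

theorem norm_rootSymbol_sq (ε : ℝ) {α : ℝ} (hα : 0 < α) (ξ : Space d) :
    ‖rootSymbol ε α ξ‖ ^ 2 = (symbol ε α ξ)⁻¹ := by
  rw [norm_rootSymbol, inv_pow, Real.sq_sqrt (symbol_pos ε hα ξ).le]

theorem conj_rootSymbol (ε α : ℝ) (ξ : Space d) :
    starRingEnd ℂ (rootSymbol ε α ξ) = rootSymbol ε α ξ := Complex.conj_ofReal _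

theorem rootSymbol_mul_self (ε : ℝ) {α : ℝ} (hα : 0 < α) (ξ : Space d) :
    rootSymbol ε α ξ * rootSymbol ε α ξ = greenSymbol d ε α ξ := by
  rw [rootSymbol, greenSymbol_eq, ← Complex.ofReal_mul, ← mul_inv,
    Real.mul_self_sqrt (symbol_pos ε hα ξ).le]

theorem symbol_mul_greenSymbol (ε : ℝ) {α : ℝ} (hα : 0 < α) (ξ : Space d) :
    (symbol ε α ξ : ℂ) * greenSymbol d ε α ξ = 1 := by
  rw [greenSymbol_eq, ← Complex.ofReal_mul, mul_inv_cancel₀ (symbol_pos ε hα ξ).ne',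
    Complex.ofReal_one]

theorem norm_rootSymbol_le (ε : ℝ) {α : ℝ} (hα : 0 < α) (ξ : Space d) :
    ‖rootSymbol ε α ξ‖ ≤ (√α)⁻¹ := by
  rw [norm_rootSymbol]
  have := Real.sqrt_pos.2 hα
  gcongr
  exact le_symbol ε α ξ

theorem memLp_rootSymbol (hd : d ≤ 3) {ε α : ℝ} (hε : 0 < ε) (hα : 0 < α) :
    MemLp (rootSymbol (d := d) ε α) 2 volume := by
  rw [memLp_two_iff_integrable_sq_norm (continuous_rootSymbol ε hα).aestronglyMeasurable]
  simpa only [norm_rootSymbol_sq ε hα] using integrable_inv_symbol hd hε hα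

/-- The integrals of the Green symbols tend to `0`. -/
theorem tendsto_integral_inv_symbol (hd : d ≤ 3) {ε : ℝ} (hε : 0 < ε) :
    Tendsto (fun α => ∫ ξ : Space d, (symbol ε α ξ)⁻¹) atTop (𝓝 0) := by
  have h : ∫ _ : Space d, (0 : ℝ) = 0 := by simp
  rw [← h]
  refine tendsto_integral_filter_of_dominated_convergence (fun ξ => (symbol ε 1 ξ)⁻¹) ?_ ?_
    (integrable_inv_symbol hd hε one_pos) ?_
  · filter_upwards [eventually_gt_atTop 0] with α hα
    exact ((continuous_symbol ε α).inv₀ fun ξ => (symbol_pos ε hα ξ).ne').aestronglyMeasurable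
  · filter_upwards [eventually_ge_atTop 1] with α hα
    refine Eventually.of_forall fun ξ => ?_
    have h1 := symbol_pos ε (one_pos.trans_le hα) ξ
    have h2 := symbol_pos ε one_pos ξ
    rw [Real.norm_of_nonneg (by positivity)]
    gcongr
    unfold symbol
    gcongr
  · refine Eventually.of_forall fun ξ => ?_
    exact (tendsto_atTop_mono (fun α => le_symbol ε α ξ) tendsto_id).inv_tendsto_atTop

/-! ### The Green functions -/

theorem greenL2_eq (hd : d ≤ 3) (ε : ℝ) {α : ℝ} (hα : 0 < α) :
    greenL2 d ε α = 𝓕⁻ ((memLp_greenSymbol hd ε hα).toLp (greenSymbol d ε α)) := by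
  rw [greenL2, dif_pos (memLp_greenSymbol hd ε hα)]

theorem green_ae_eq (d : ℕ) (ε α : ℝ) : greenL2 d ε α =ᵐ[volume] green d ε α := by
  unfold green
  split_ifs with h
  · exact h.choose_spec.2
  · rfl

theorem stronglyMeasurable_green (d : ℕ) (ε α : ℝ) : StronglyMeasurable (green d ε α) := by
  unfold green
  split_ifs with h
  · exact h.choose_spec.1.stronglyMeasurable
  · exact Lp.stronglyMeasurable _

/-- For `ε > 0` the Green function is the continuous inverse Fourier transform of its symbol. -/
theorem green_eq (hd : d ≤ 3) {ε α : ℝ} (hε : 0 < ε) (hα : 0 < α) :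
    green d ε α = 𝓕⁻ (greenSymbol d ε α) := by
  have hi := integrable_greenSymbol hd hε hα
  have hmem := memLp_greenSymbol hd ε hα
  have h1 : greenL2 d ε α =ᵐ[volume] 𝓕⁻ (greenSymbol d ε α) := by
    rw [greenL2_eq hd ε hα]
    refine (L2.fourierInv_ae_eq _ (hi.congr hmem.coeFn_toLp.symm)).trans ?_
    refine Eventually.of_forall fun x => ?_
    rw [fourierInv_eq_planeWave, fourierInv_eq_planeWave]
    refine integral_congr_ae (hmem.coeFn_toLp.mono fun ξ hξ => ?_)
    beta_reduce
    rw [hξ]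
  have hc := continuous_fourierInv hi
  have h : ∃ g : Space d → ℂ, Continuous g ∧ greenL2 d ε α =ᵐ[volume] g := ⟨_, hc, h1⟩
  have h2 : Continuous (green d ε α) := by
    unfold green
    rw [dif_pos h]
    exact h.choose_spec.1
  exact (Continuous.ae_eq_iff_eq volume h2 hc).1 ((green_ae_eq d ε α).symm.trans h1)

theorem continuous_green (hd : d ≤ 3) {ε α : ℝ} (hε : 0 < ε) (hα : 0 < α) :
    Continuous (green d ε α) := by
  rw [green_eq hd hε hα]
  exact continuous_fourierInv (integrable_greenSymbol hd hε hα)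

theorem norm_green_le (hd : d ≤ 3) {ε α : ℝ} (hε : 0 < ε) (hα : 0 < α) (x : Space d) :
    ‖green d ε α x‖ ≤ ∫ ξ : Space d, (symbol ε α ξ)⁻¹ := by
  rw [green_eq hd hε hα]
  refine (norm_fourierInv_le _ x).trans_eq ?_
  simp only [norm_greenSymbol ε hα]

theorem green_neg (hd : d ≤ 3) {ε α : ℝ} (hε : 0 < ε) (hα : 0 < α) (x : Space d) :
    green d ε α (-x) = green d ε α x := by
  rw [green_eq hd hε hα, fourierInv_eq_planeWave, fourierInv_eq_planeWave,
    ← integral_neg_eq_self]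
  refine integral_congr_ae (Eventually.of_forall fun ξ => ?_)
  simp only [greenSymbol, norm_neg, planeWave, inner_neg_neg]

theorem memLp_green (d : ℕ) (ε α : ℝ) :
    MemLp (green d ε α) 2 volume :=
  (Lp.memLp (greenL2 d ε α)).ae_eq (green_ae_eq d ε α)

end MeasurePerturbation

namespace MeasurePerturbation

variable {d : ℕ}

/-! ### The square root of the free resolvent -/

theorem memLp_rootSymbol_mul (ε : ℝ) {α : ℝ} (hα : 0 < α) (x : L2 d) :
    MemLp (fun ξ => rootSymbol ε α ξ * x ξ) 2 volume :=
  (Lp.memLp x).of_le_mul (c := (√α)⁻¹)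
    ((continuous_rootSymbol ε hα).aestronglyMeasurable.mul (Lp.aestronglyMeasurable x))
    (Eventually.of_forall fun ξ => by
      rw [norm_mul]; gcongr; exact norm_rootSymbol_le ε hα ξ)

/-- Multiplication with the square root of the Green symbol. -/
noncomputable def rootMul (ε : ℝ) {α : ℝ} (hα : 0 < α) : L2 d →L[ℂ] L2 d :=
  LinearMap.mkContinuous
    { toFun := fun x => (memLp_rootSymbol_mul ε hα x).toLp _
      map_add' := fun x y => by
        refine Lp.ext ?_
        filter_upwards [(memLp_rootSymbol_mul ε hα (x + y)).coeFn_toLp,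
          (memLp_rootSymbol_mul ε hα x).coeFn_toLp, (memLp_rootSymbol_mul ε hα y).coeFn_toLp,
          Lp.coeFn_add x y, Lp.coeFn_add ((memLp_rootSymbol_mul ε hα x).toLp _)
            ((memLp_rootSymbol_mul ε hα y).toLp _)] with ξ h1 h2 h3 h4 h5
        rw [h1, h5, Pi.add_apply, h2, h3, h4, Pi.add_apply, mul_add]
      map_smul' := fun c x => by
        refine Lp.ext ?_
        filter_upwards [(memLp_rootSymbol_mul ε hα (c • x)).coeFn_toLp,
          (memLp_rootSymbol_mul ε hα x).coeFn_toLp, Lp.coeFn_smul c x,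
          Lp.coeFn_smul c ((memLp_rootSymbol_mul ε hα x).toLp _)] with ξ h1 h2 h3 h4
        rw [h1, RingHom.id_apply, h4, Pi.smul_apply, h2, h3, Pi.smul_apply, smul_eq_mul,
          smul_eq_mul, mul_left_comm] }
    (√α)⁻¹ fun x => by
      refine Lp.norm_le_mul_norm_of_ae_le_mul ?_
      filter_upwards [(memLp_rootSymbol_mul ε hα x).coeFn_toLp] with ξ hξ
      change ‖((memLp_rootSymbol_mul ε hα x).toLp _ : L2 d) ξ‖ ≤ _
      rw [hξ, norm_mul]
      gcongr
      exact norm_rootSymbol_le ε hα ξ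

theorem rootMul_ae_eq (ε : ℝ) {α : ℝ} (hα : 0 < α) (x : L2 d) :
    rootMul ε hα x =ᵐ[volume] fun ξ => rootSymbol ε α ξ * x ξ :=
  (memLp_rootSymbol_mul ε hα x).coeFn_toLp

/-- The operator `x ↦ 𝓕⁻ (root of the Green symbol * x)`, a square root of the free resolvent up
to the Fourier transform. -/
noncomputable def resolventRoot (ε : ℝ) {α : ℝ} (hα : 0 < α) : L2 d →L[ℂ] L2 d :=
  (Lp.fourierTransformₗᵢ (Space d) ℂ).symm.toContinuousLinearEquiv.toContinuousLinearMap ∘L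
    rootMul ε hα

theorem resolventRoot_apply (ε : ℝ) {α : ℝ} (hα : 0 < α) (x : L2 d) :
    resolventRoot ε hα x = 𝓕⁻ (rootMul ε hα x) := rfl

theorem fourier_resolventRoot (ε : ℝ) {α : ℝ} (hα : 0 < α) (x : L2 d) :
    𝓕 (resolventRoot ε hα x) = rootMul ε hα x := by
  rw [resolventRoot_apply, FourierTransform.fourier_fourierInv_eq]

theorem hasTemperateGrowth_weight : Function.HasTemperateGrowth
    (fun ξ : Space d => (((1 + ‖ξ‖ ^ 2) ^ ((2 : ℝ) / 2) : ℝ) : ℂ)) := by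
  fun_prop

/-- The symbol is bounded above and below by multiples of `(1 + |ξ|²)²`. Dividing `𝓕 f` by the root
of the Green symbol therefore stays in `L²` exactly when multiplying it by the Sobolev weight does.
-/
theorem mem_H2_iff {ε α : ℝ} (hε : 0 < ε) (hα : 0 < α) (f : L2 d) :
    f ∈ H2 d ↔ ∃ x : L2 d, resolventRoot ε hα x = f := by
  change TemperedDistribution.MemSobolev 2 2 (f : 𝓢'(Space d, ℂ)) ↔ _
  rw [TemperedDistribution.memSobolev_iff_exists_smulLeftCLM_fourier,
    Lp.fourier_toTemperedDistribution_eq]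
  have hpow : ∀ ξ : Space d, (1 + ‖ξ‖ ^ 2) ^ ((2 : ℝ) / 2) = 1 + ‖ξ‖ ^ 2 := fun ξ => by norm_num
  have hκ := symbolConst_pos hε hα
  constructor
  · rintro ⟨v, hv⟩
    have hv' := L2.ae_eq_mul_of_smulLeftCLM_eq hasTemperateGrowth_weight hv
    have hmem : MemLp (fun ξ => (rootSymbol ε α ξ)⁻¹ * (𝓕 f : L2 d) ξ) 2 volume := by
      refine (Lp.memLp v).of_le_mul
        (c := √(ε ^ 2 * (2 * Real.pi) ^ 4 + (2 * Real.pi) ^ 2 + α))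
        (((continuous_rootSymbol ε hα).inv₀ (rootSymbol_ne_zero ε hα)).aestronglyMeasurable.mul
          (Lp.aestronglyMeasurable _)) (hv'.mono fun ξ hξ => ?_)
      rw [hξ, norm_mul, norm_mul, ← mul_assoc, norm_inv, norm_rootSymbol, inv_inv]
      gcongr
      rw [Complex.norm_real, hpow, Real.norm_of_nonneg (by positivity)]
      refine (Real.sqrt_le_sqrt (symbol_le ε hα ξ)).trans_eq ?_
      rw [Real.sqrt_mul (by positivity), Real.sqrt_sq (by positivity)]
    refine ⟨hmem.toLp _, ?_⟩
    have h1 : rootMul ε hα (hmem.toLp _) = 𝓕 f := by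
      refine Lp.ext ?_
      filter_upwards [rootMul_ae_eq ε hα (hmem.toLp _), hmem.coeFn_toLp] with ξ h1 h2
      rw [h1, h2, mul_inv_cancel_left₀ (rootSymbol_ne_zero ε hα ξ)]
    rw [resolventRoot_apply, h1, FourierTransform.fourierInv_fourier_eq]
  · rintro ⟨x, rfl⟩
    have hmem : MemLp (fun ξ => (((1 + ‖ξ‖ ^ 2) ^ ((2 : ℝ) / 2) : ℝ) : ℂ) * rootMul ε hα x ξ) 2
        volume := by
      refine (Lp.memLp x).of_le_mul (c := √(symbolConst ε α))
        (hasTemperateGrowth_weight.1.continuous.aestronglyMeasurable.mul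
          (Lp.aestronglyMeasurable _)) ((rootMul_ae_eq ε hα x).mono fun ξ hξ => ?_)
      rw [hξ, norm_mul, norm_mul, ← mul_assoc, norm_rootSymbol]
      gcongr
      rw [Complex.norm_real, hpow, Real.norm_of_nonneg (by positivity), ← div_eq_mul_inv,
        div_le_iff₀ (Real.sqrt_pos.2 (symbol_pos ε hα ξ)), ← Real.sqrt_mul hκ.le]
      exact Real.le_sqrt_of_sq_le (sq_one_add_norm_sq_le_symbol hε hα ξ)
    refine ⟨hmem.toLp _, L2.smulLeftCLM_eq hasTemperateGrowth_weight ?_⟩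
    rw [fourier_resolventRoot]
    exact hmem.coeFn_toLp

theorem schwartz_toLp_mem_H2 (φ : 𝓢(Space d, ℂ)) : φ.toLp 2 volume ∈ H2 d := by
  change TemperedDistribution.MemSobolev 2 2 ((φ.toLp 2 volume : L2 d) : 𝓢'(Space d, ℂ))
  rw [Lp.toTemperedDistribution_toLp_eq]
  exact φ.memSobolev

theorem dense_H2 (d : ℕ) : Dense (H2 d : Set (L2 d)) := by
  have h : DenseRange (SchwartzMap.toLpCLM ℝ (E := Space d) ℂ 2 volume) :=
    SchwartzMap.denseRange_toLpCLM (by norm_num)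
  intro f
  refine closure_mono ?_ (h f)
  intro g hg
  obtain ⟨φ, hφ⟩ := hg
  have := schwartz_toLp_mem_H2 φ
  rw [SchwartzMap.toLpCLM_apply] at hφ
  rw [← hφ]
  exact this

theorem fourier_laplacianH2 (f : H2 d) : (𝓕 (laplacianH2 d f) : L2 d) =ᵐ[volume]
    fun ξ => (-(2 * Real.pi * ‖ξ‖) ^ 2 : ℝ) * (𝓕 (f : L2 d) : L2 d) ξ := by
  have h1 : (laplacianH2 d f : 𝓢'(Space d, ℂ)) = Δ ((f : L2 d) : 𝓢'(Space d, ℂ)) :=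
    (restrictH2_spec _ _ f).trans (TemperedDistribution.laplacianCLM_apply _)
  have hw : Function.HasTemperateGrowth (fun ξ : Space d => Complex.ofReal (‖ξ‖ ^ 2)) := by
    fun_prop
  have hw' : Function.HasTemperateGrowth
      (fun ξ : Space d => ((-(2 * Real.pi * ‖ξ‖) ^ 2 : ℝ) : ℂ)) := by
    simp only [mul_pow]
    fun_prop
  refine L2.ae_eq_mul_of_smulLeftCLM_eq hw' ?_
  rw [← Lp.fourier_toTemperedDistribution_eq, ← Lp.fourier_toTemperedDistribution_eq, h1,
    TemperedDistribution.laplacian_eq_fourierMultiplierCLM,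
    TemperedDistribution.fourierMultiplierCLM_apply]
  have e : (fun ξ : Space d => ((-(2 * Real.pi * ‖ξ‖) ^ 2 : ℝ) : ℂ)) =
      (-(2 * Real.pi) ^ 2 : ℂ) • fun ξ : Space d => Complex.ofReal (‖ξ‖ ^ 2) := by
    ext ξ
    simp only [Pi.smul_apply, smul_eq_mul]
    push_cast
    ring
  rw [e, TemperedDistribution.smulLeftCLM_smul hw]
  rw [← Complex.coe_smul, FourierTransform.fourier_smul, FourierTransform.fourier_fourierInv_eq]
  push_cast
  rfl

theorem fourier_partialH2 (j : Fin d) (f : H2 d) : (𝓕 (partialH2 j f) : L2 d) =ᵐ[volume]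
    fun ξ => (2 * Real.pi * Complex.I * (ξ j : ℝ)) * (𝓕 (f : L2 d) : L2 d) ξ := by
  have h1 : (partialH2 j f : 𝓢'(Space d, ℂ)) =
      ∂_{(EuclideanSpace.single j (1 : ℝ) : Space d)} ((f : L2 d) : 𝓢'(Space d, ℂ)) :=
    restrictH2_spec _ _ f
  have hw : Function.HasTemperateGrowth
      (fun ξ : Space d => Complex.ofReal (inner ℝ ξ (EuclideanSpace.single j (1 : ℝ)))) := by
    fun_prop
  have e : (fun ξ : Space d => (2 * Real.pi * Complex.I * (ξ j : ℝ))) =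
      (2 * Real.pi * Complex.I : ℂ) •
        fun ξ : Space d => Complex.ofReal (inner ℝ ξ (EuclideanSpace.single j (1 : ℝ))) := by
    ext ξ
    simp [EuclideanSpace.inner_single_right]
  have hw' : Function.HasTemperateGrowth
      (fun ξ : Space d => (2 * Real.pi * Complex.I * (ξ j : ℝ))) := by
    rw [e]
    exact (Function.HasTemperateGrowth.const _).mul hw
  refine L2.ae_eq_mul_of_smulLeftCLM_eq hw' ?_
  rw [← Lp.fourier_toTemperedDistribution_eq, ← Lp.fourier_toTemperedDistribution_eq, h1,
    TemperedDistribution.lineDeriv_eq_fourierMultiplierCLM,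
    TemperedDistribution.fourierMultiplierCLM_apply]
  rw [e, TemperedDistribution.smulLeftCLM_smul hw]
  rw [FourierTransform.fourier_smul, FourierTransform.fourier_fourierInv_eq]
  rfl

end MeasurePerturbation

namespace MeasurePerturbation

variable {d : ℕ}

/-! ### The unperturbed form -/

theorem L2.inner_eq_integral (f h : L2 d) : inner ℂ f h =
    ∫ ξ, starRingEnd ℂ (f ξ) * h ξ := by
  rw [L2.inner_def]
  refine integral_congr_ae (Eventually.of_forall fun ξ => ?_)
  simp only [RCLike.inner_apply, mul_comm]

theorem L2.inner_eq_integral_fourier (f h : L2 d) : inner ℂ f h =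
    ∫ ξ, starRingEnd ℂ ((𝓕 f : L2 d) ξ) * (𝓕 h : L2 d) ξ :=
  (Lp.inner_fourier_eq f h).symm.trans (L2.inner_eq_integral _ _)

theorem L2.integrable_conj_mul (f h : L2 d) : Integrable (fun ξ => starRingEnd ℂ (f ξ) * h ξ) := by
  refine (L2.integrable_inner (𝕜 := ℂ) f h).congr (Eventually.of_forall fun ξ => ?_)
  simp only [RCLike.inner_apply, mul_comm]

/-- Plancherel for each term. Every product is integrable because `Δ f`, `∂ⱼ f` and `f` are in `L²`,
so the integrals may be added before the symbol is assembled. -/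
theorem freeForm_eq (ε α : ℝ) (f h : H2 d) :
    (ε : ℂ) ^ 2 * inner ℂ (laplacianH2 d f) (laplacianH2 d h)
      + ∑ j : Fin d, inner ℂ (partialH2 j f) (partialH2 j h) + α * inner ℂ (f : L2 d) (h : L2 d) =
    ∫ ξ, (symbol ε α ξ : ℂ) * (starRingEnd ℂ ((𝓕 (f : L2 d) : L2 d) ξ) *
      (𝓕 (h : L2 d) : L2 d) ξ) := by
  simp only [L2.inner_eq_integral_fourier]
  rw [← integral_finsetSum _ fun j _ => L2.integrable_conj_mul _ _, ← integral_const_mul,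
    ← integral_const_mul, ← integral_add, ← integral_add]
  · have hp : ∀ᵐ ξ, ∀ j, (𝓕 (partialH2 j f) : L2 d) ξ =
          (2 * Real.pi * Complex.I * (ξ j : ℝ)) * (𝓕 (f : L2 d) : L2 d) ξ ∧
        (𝓕 (partialH2 j h) : L2 d) ξ =
          (2 * Real.pi * Complex.I * (ξ j : ℝ)) * (𝓕 (h : L2 d) : L2 d) ξ := by
      rw [ae_all_iff]
      exact fun j => (fourier_partialH2 j f).and (fourier_partialH2 j h)
    refine integral_congr_ae ?_
    filter_upwards [fourier_laplacianH2 f, fourier_laplacianH2 h, hp] with ξ h1 h2 h3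
    have h4 : ∀ j, starRingEnd ℂ ((𝓕 (partialH2 j f) : L2 d) ξ) * (𝓕 (partialH2 j h) : L2 d) ξ =
        (((2 * Real.pi) ^ 2 * ‖ξ j‖ ^ 2 : ℝ) : ℂ) *
          (starRingEnd ℂ ((𝓕 (f : L2 d) : L2 d) ξ) * (𝓕 (h : L2 d) : L2 d) ξ) := by
      intro j
      rw [(h3 j).1, (h3 j).2, Real.norm_eq_abs, sq_abs]
      simp only [map_mul, Complex.conj_ofReal, Complex.conj_I, map_ofNat]
      push_cast
      linear_combination (-4 * (Real.pi : ℂ) ^ 2 * (ξ j : ℂ) ^ 2 *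
        (starRingEnd ℂ ((𝓕 (f : L2 d) : L2 d) ξ) * (𝓕 (h : L2 d) : L2 d) ξ)) * Complex.I_sq
    simp only [h4, ← Finset.sum_mul, ← Complex.ofReal_sum, ← Finset.mul_sum,
      ← EuclideanSpace.norm_sq_eq]
    rw [h1, h2]
    simp only [symbol, map_mul, Complex.conj_ofReal]
    push_cast
    ring
  · exact ((L2.integrable_conj_mul _ _).const_mul _).add
      (integrable_finsetSum _ fun j _ => L2.integrable_conj_mul _ _)
  · exact (L2.integrable_conj_mul _ _).const_mul _
  · exact (L2.integrable_conj_mul _ _).const_mul _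
  · exact integrable_finsetSum _ fun j _ => L2.integrable_conj_mul _ _

/-- In Fourier space the two roots multiply to the inverse of the symbol and cancel it. -/
theorem freeForm_resolventRoot (ε : ℝ) {α : ℝ} (hα : 0 < α) (x y : L2 d)
    (hx : resolventRoot ε hα x ∈ H2 d) (hy : resolventRoot ε hα y ∈ H2 d) :
    (ε : ℂ) ^ 2 * inner ℂ (laplacianH2 d ⟨_, hy⟩) (laplacianH2 d ⟨_, hx⟩)
      + ∑ j : Fin d, inner ℂ (partialH2 j ⟨_, hy⟩) (partialH2 j ⟨_, hx⟩)
      + α * inner ℂ (resolventRoot ε hα y) (resolventRoot ε hα x) = inner ℂ y x := by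
  rw [freeForm_eq ε α ⟨_, hy⟩ ⟨_, hx⟩, L2.inner_def]
  simp only [fourier_resolventRoot]
  refine integral_congr_ae ?_
  filter_upwards [rootMul_ae_eq ε hα x, rootMul_ae_eq ε hα y] with ξ h1 h2
  rw [h1, h2, map_mul, conj_rootSymbol, RCLike.inner_apply]
  linear_combination (starRingEnd ℂ (y ξ) * x ξ) * symbol_mul_greenSymbol ε hα ξ +
    (symbol ε α ξ * starRingEnd ℂ (y ξ) * x ξ) * rootSymbol_mul_self ε hα ξ

/-! ### Evaluation of the continuous representative -/

theorem memLp_evalVector (hd : d ≤ 3) {ε α : ℝ} (hε : 0 < ε) (hα : 0 < α) (z : Space d) :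
    MemLp (fun ξ => starRingEnd ℂ (planeWave ξ z) * rootSymbol ε α ξ) 2 volume := by
  refine (memLp_rootSymbol hd hε hα).of_le_mul (c := 1) ?_ (Eventually.of_forall fun ξ => ?_)
  · refine Continuous.aestronglyMeasurable (Continuous.mul ?_ (continuous_rootSymbol ε hα))
    exact Complex.continuous_conj.comp (by fun_prop)
  · simp

/-- The vector that represents the evaluation of the continuous representative of
`resolventRoot x` at `z`. -/
noncomputable def evalVector (hd : d ≤ 3) {ε α : ℝ} (hε : 0 < ε) (hα : 0 < α) (z : Space d) :
    L2 d :=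
  (memLp_evalVector hd hε hα z).toLp _

theorem evalVector_ae_eq (hd : d ≤ 3) {ε α : ℝ} (hε : 0 < ε) (hα : 0 < α) (z : Space d) :
    evalVector hd hε hα z =ᵐ[volume]
      fun ξ => starRingEnd ℂ (planeWave ξ z) * rootSymbol ε α ξ :=
  (memLp_evalVector hd hε hα z).coeFn_toLp

/-- The plane wave has modulus one, so the norm does not depend on the point; this gives the uniform
bound on point evaluations. -/
theorem norm_evalVector_sq (hd : d ≤ 3) {ε α : ℝ} (hε : 0 < ε) (hα : 0 < α) (z : Space d) :
    ‖evalVector hd hε hα z‖ ^ 2 = ∫ ξ : Space d, (symbol ε α ξ)⁻¹ := by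
  have h1 : ((‖evalVector hd hε hα z‖ ^ 2 : ℝ) : ℂ) =
      inner ℂ (evalVector hd hε hα z) (evalVector hd hε hα z) := by
    rw [inner_self_eq_norm_sq_to_K]
    push_cast
    rfl
  rw [L2.inner_def] at h1
  rw [← Complex.ofReal_inj, h1, ← integral_complex_ofReal]
  refine integral_congr_ae ((evalVector_ae_eq hd hε hα z).mono fun ξ hξ => ?_)
  beta_reduce
  rw [hξ, inner_self_eq_norm_sq_to_K, norm_mul, RCLike.norm_conj, norm_planeWave, one_mul,
    ← norm_rootSymbol_sq ε hα]
  push_cast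
  rfl

theorem inner_evalVector (hd : d ≤ 3) {ε α : ℝ} (hε : 0 < ε) (hα : 0 < α) (z : Space d)
    (x : L2 d) : inner ℂ (evalVector hd hε hα z) x =
      ∫ ξ, planeWave ξ z * (rootSymbol ε α ξ * x ξ) := by
  rw [L2.inner_def]
  refine integral_congr_ae ((evalVector_ae_eq hd hε hα z).mono fun ξ hξ => ?_)
  beta_reduce
  rw [hξ, RCLike.inner_apply, map_mul, Complex.conj_conj, conj_rootSymbol]
  ring

theorem integrable_rootMul (hd : d ≤ 3) {ε α : ℝ} (hε : 0 < ε) (hα : 0 < α) (x : L2 d) :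
    Integrable (rootMul ε hα x) :=
  ((memLp_rootSymbol hd hε hα).integrable_mul (Lp.memLp x)).congr (rootMul_ae_eq ε hα x).symm

theorem contRep_eq_fourierInv (hd : d ≤ 3) (f : H2 d)
    (hf : Integrable (𝓕 (f : L2 d) : L2 d)) (z : Space d) :
    contRep hd f z = 𝓕⁻ ((𝓕 (f : L2 d) : L2 d) : Space d → ℂ) z := by
  have h1 := L2.fourierInv_ae_eq (𝓕 (f : L2 d)) hf
  rw [FourierTransform.fourierInv_fourier_eq] at h1
  exact congrFun ((Continuous.ae_eq_iff_eq volume (contRep hd f).continuous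
    (continuous_fourierInv hf)).1 ((contRep_spec hd f).symm.trans h1)) z

theorem contRep_resolventRoot (hd : d ≤ 3) {ε α : ℝ} (hε : 0 < ε) (hα : 0 < α) (x : L2 d)
    (hx : resolventRoot ε hα x ∈ H2 d) (z : Space d) :
    contRep hd ⟨resolventRoot ε hα x, hx⟩ z = inner ℂ (evalVector hd hε hα z) x := by
  rw [contRep_eq_fourierInv, inner_evalVector, fourierInv_eq_planeWave]
  · simp only [fourier_resolventRoot]
    refine integral_congr_ae ((rootMul_ae_eq ε hα x).mono fun ξ hξ => ?_)
    beta_reduce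
    rw [hξ]
  · simp only [fourier_resolventRoot]
    exact integrable_rootMul hd hε hα x

/-- The continuous representative of `resolventRoot x`. -/
noncomputable def evalMap (hd : d ≤ 3) {ε α : ℝ} (hε : 0 < ε) (hα : 0 < α) :
    L2 d →ₗ[ℂ] (Space d →ᵇ ℂ) :=
  contRep hd ∘ₗ (resolventRoot ε hα).toLinearMap.codRestrict (H2 d)
    fun x => (mem_H2_iff hε hα _).2 ⟨x, rfl⟩

theorem evalMap_apply (hd : d ≤ 3) {ε α : ℝ} (hε : 0 < ε) (hα : 0 < α) (x : L2 d)
    (z : Space d) : evalMap hd hε hα x z = inner ℂ (evalVector hd hε hα z) x :=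
  contRep_resolventRoot hd hε hα x _ z

theorem evalMap_eq_contRep (hd : d ≤ 3) {ε α : ℝ} (hε : 0 < ε) (hα : 0 < α) (x : L2 d)
    (hx : resolventRoot ε hα x ∈ H2 d) :
    contRep hd ⟨resolventRoot ε hα x, hx⟩ = evalMap hd hε hα x := rfl

theorem norm_evalMap_le (hd : d ≤ 3) {ε α : ℝ} (hε : 0 < ε) (hα : 0 < α) (x : L2 d)
    (z : Space d) :
    ‖evalMap hd hε hα x z‖ ≤ √(∫ ξ : Space d, (symbol ε α ξ)⁻¹) * ‖x‖ := by
  rw [evalMap_apply, ← norm_evalVector_sq hd hε hα z, Real.sqrt_sq (norm_nonneg _)]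
  exact norm_inner_le_norm _ _

/-- The reproducing kernel property: the two plane waves combine to `t - z` and the two roots to the
Green symbol. -/
theorem evalMap_evalVector (hd : d ≤ 3) {ε α : ℝ} (hε : 0 < ε) (hα : 0 < α) (t z : Space d) :
    evalMap hd hε hα (evalVector hd hε hα z) t = green d ε α (t - z) := by
  rw [evalMap_apply, inner_evalVector, green_eq hd hε hα, fourierInv_eq_planeWave]
  refine integral_congr_ae ((evalVector_ae_eq hd hε hα z).mono fun ξ hξ => ?_)
  beta_reduce
  rw [hξ, planeWave_sub_right, ← rootSymbol_mul_self ε hα]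
  ring

end MeasurePerturbation

namespace MeasurePerturbation

variable {d : ℕ}

/-! ### The perturbation as a bounded operator -/

/-- The integral of the Green symbol, the value of the Green function at `0`. -/
noncomputable def greenMass (d : ℕ) (ε α : ℝ) : ℝ := ∫ ξ : Space d, (symbol ε α ξ)⁻¹

theorem greenMass_nonneg (d : ℕ) (ε : ℝ) {α : ℝ} (hα : 0 < α) : 0 ≤ greenMass d ε α :=
  integral_nonneg fun ξ => (inv_pos.2 (symbol_pos ε hα ξ)).le

/-- The form `∫ conj f̃ h̃ dμ`, transported by `resolventRoot`. -/
noncomputable def measureForm (hd : d ≤ 3) {ε α : ℝ} (hε : 0 < ε) (hα : 0 < α)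
    (μ : SignedMeasure (Space d)) : L2 d →ₗ⋆[ℂ] L2 d →ₗ[ℂ] ℂ :=
  LinearMap.mk₂'ₛₗ (starRingEnd ℂ) (RingHom.id ℂ)
    (fun y x => signedIntegral μ
      (fun z => starRingEnd ℂ (evalMap hd hε hα y z) * evalMap hd hε hα x z))
    (by
      intro f f' h
      simp only [map_add, BoundedContinuousFunction.coe_add, Pi.add_apply, add_mul]
      exact signedIntegral_add (integrable_rep μ _ _).1 (integrable_rep μ _ _).1
        (integrable_rep μ _ _).2 (integrable_rep μ _ _).2)
    (by
      intro c f h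
      simp only [map_smul, BoundedContinuousFunction.coe_smul, smul_eq_mul,
        map_mul, mul_assoc, signedIntegral_const_mul])
    (by
      intro f h h'
      simp only [map_add, BoundedContinuousFunction.coe_add, Pi.add_apply, mul_add]
      exact signedIntegral_add (integrable_rep μ _ _).1 (integrable_rep μ _ _).1
        (integrable_rep μ _ _).2 (integrable_rep μ _ _).2)
    (by
      intro c f h
      simp only [map_smul, BoundedContinuousFunction.coe_smul, smul_eq_mul,
        mul_left_comm _ c, signedIntegral_const_mul, RingHom.id_apply])

/-- Each point evaluation contributes a factor `√g_{ε,α}(0)`. -/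
theorem norm_measureForm_le (hd : d ≤ 3) {ε α : ℝ} (hε : 0 < ε) (hα : 0 < α)
    (μ : SignedMeasure (Space d)) (y x : L2 d) : ‖measureForm hd hε hα μ y x‖ ≤
      greenMass d ε α * μ.totalVariation.real Set.univ * ‖y‖ * ‖x‖ := by
  have hc := greenMass_nonneg d ε hα
  refine (norm_signedIntegral_le μ (C := greenMass d ε α * ‖y‖ * ‖x‖) fun z => ?_).trans_eq
    (by ring)
  rw [norm_mul, RCLike.norm_conj]
  calc _ ≤ (√(greenMass d ε α) * ‖y‖) * (√(greenMass d ε α) * ‖x‖) :=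
        mul_le_mul (norm_evalMap_le hd hε hα y z) (norm_evalMap_le hd hε hα x z)
          (norm_nonneg _) (by positivity)
    _ = (√(greenMass d ε α) * √(greenMass d ε α)) * ‖y‖ * ‖x‖ := by ring
    _ = _ := by rw [Real.mul_self_sqrt hc]

/-- The bounded operator associated to `measureForm`. -/
noncomputable def measureOp (hd : d ≤ 3) {ε α : ℝ} (hε : 0 < ε) (hα : 0 < α)
    (μ : SignedMeasure (Space d)) : L2 d →L[ℂ] L2 d :=
  InnerProductSpace.continuousLinearMapOfBilin
    (LinearMap.mkContinuous₂ (measureForm hd hε hα μ)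
      (greenMass d ε α * μ.totalVariation.real Set.univ) (norm_measureForm_le hd hε hα μ))

theorem measureOp_inner_left (hd : d ≤ 3) {ε α : ℝ} (hε : 0 < ε) (hα : 0 < α)
    (μ : SignedMeasure (Space d)) (y x : L2 d) :
    inner ℂ (measureOp hd hε hα μ y) x = signedIntegral μ
      (fun z => starRingEnd ℂ (evalMap hd hε hα y z) * evalMap hd hε hα x z) :=
  InnerProductSpace.continuousLinearMapOfBilin_apply _ _ _

theorem measureOp_inner_right (hd : d ≤ 3) {ε α : ℝ} (hε : 0 < ε) (hα : 0 < α)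
    (μ : SignedMeasure (Space d)) (y x : L2 d) :
    inner ℂ y (measureOp hd hε hα μ x) = signedIntegral μ
      (fun z => starRingEnd ℂ (evalMap hd hε hα y z) * evalMap hd hε hα x z) := by
  rw [← inner_conj_symm, measureOp_inner_left, ← signedIntegral_conj]
  simp only [map_mul, Complex.conj_conj, mul_comm]

theorem isSelfAdjoint_measureOp (hd : d ≤ 3) {ε α : ℝ} (hε : 0 < ε) (hα : 0 < α)
    (μ : SignedMeasure (Space d)) : IsSelfAdjoint (measureOp hd hε hα μ) := by
  rw [ContinuousLinearMap.isSelfAdjoint_iff_isSymmetric]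
  intro y x
  exact (measureOp_inner_left hd hε hα μ y x).trans (measureOp_inner_right hd hε hα μ y x).symm

theorem norm_measureOp_apply_le (hd : d ≤ 3) {ε α : ℝ} (hε : 0 < ε) (hα : 0 < α)
    (μ : SignedMeasure (Space d)) (x : L2 d) : ‖measureOp hd hε hα μ x‖ ≤
      greenMass d ε α * μ.totalVariation.real Set.univ * ‖x‖ := by
  have hc := greenMass_nonneg d ε hα
  set w := measureOp hd hε hα μ x
  rcases eq_or_ne w 0 with h0 | h0
  · rw [h0, norm_zero]
    positivity
  · have h1 : ‖w‖ ^ 2 ≤ greenMass d ε α * μ.totalVariation.real Set.univ * ‖w‖ * ‖x‖ := by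
      have h2 := norm_measureForm_le hd hε hα μ w x
      have h3 : measureForm hd hε hα μ w x = inner ℂ w w :=
        (measureOp_inner_right hd hε hα μ w x).symm
      rw [h3, inner_self_eq_norm_sq_to_K, norm_pow] at h2
      simpa using h2
    have h4 : 0 < ‖w‖ := norm_pos_iff.2 h0
    refine le_of_mul_le_mul_left ?_ h4
    linarith

theorem norm_measureOp_apply_le_half (hd : d ≤ 3) {ε α : ℝ} (hε : 0 < ε) (hα : 0 < α)
    {μ : SignedMeasure (Space d)}
    (hμ : greenMass d ε α * μ.totalVariation.real Set.univ ≤ 1 / 2) (x : L2 d) :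
    ‖measureOp hd hε hα μ x‖ ≤ 1 / 2 * ‖x‖ :=
  (norm_measureOp_apply_le hd hε hα μ x).trans (by gcongr)

theorem isUnit_one_add_measureOp (hd : d ≤ 3) {ε α : ℝ} (hε : 0 < ε) (hα : 0 < α)
    {μ : SignedMeasure (Space d)}
    (hμ : greenMass d ε α * μ.totalVariation.real Set.univ ≤ 1 / 2) :
    IsUnit (1 + measureOp hd hε hα μ) := by
  have h1 : ‖measureOp hd hε hα μ‖ ≤ 1 / 2 :=
    ContinuousLinearMap.opNorm_le_bound _ (by norm_num)
      (norm_measureOp_apply_le_half hd hε hα hμ)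
  have h2 : ‖-measureOp hd hε hα μ‖ < 1 := by
    rw [norm_neg]
    linarith
  simpa using isUnit_one_sub_of_norm_lt_one h2

/-- With `w = (1 + B)⁻¹ x` one has `‖w‖ ≤ ‖x‖ + ‖w‖ / 2`. -/
theorem norm_inverse_one_add_measureOp_le (hd : d ≤ 3) {ε α : ℝ} (hε : 0 < ε) (hα : 0 < α)
    {μ : SignedMeasure (Space d)}
    (hμ : greenMass d ε α * μ.totalVariation.real Set.univ ≤ 1 / 2) (x : L2 d) :
    ‖Ring.inverse (1 + measureOp hd hε hα μ) x‖ ≤ 2 * ‖x‖ := by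
  set w := Ring.inverse (1 + measureOp hd hε hα μ) x with hw
  have h1 : w + measureOp hd hε hα μ w = x :=
    congrArg (fun S : L2 d →L[ℂ] L2 d => S x)
      (Ring.mul_inverse_cancel _ (isUnit_one_add_measureOp hd hε hα hμ))
  have h2 := norm_measureOp_apply_le_half hd hε hα hμ w
  have h3 : w = x - measureOp hd hε hα μ w := by rw [← h1, add_sub_cancel_right]
  have h4 : ‖w‖ ≤ ‖x‖ + ‖measureOp hd hε hα μ w‖ := by
    conv_lhs => rw [h3]
    exact norm_sub_le _ _
  linarith

theorem isSelfAdjoint_one_add_measureOp (hd : d ≤ 3) {ε α : ℝ} (hε : 0 < ε) (hα : 0 < α)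
    (μ : SignedMeasure (Space d)) : IsSelfAdjoint (1 + measureOp hd hε hα μ) :=
  (IsSelfAdjoint.one _).add (isSelfAdjoint_measureOp hd hε hα μ)

/-- The resolvent of the perturbed operator at `-α`. -/
noncomputable def perturbedResolvent (hd : d ≤ 3) {ε α : ℝ} (hε : 0 < ε) (hα : 0 < α)
    (μ : SignedMeasure (Space d)) : L2 d →L[ℂ] L2 d :=
  resolventRoot ε hα ∘L Ring.inverse (1 + measureOp hd hε hα μ) ∘L
    ContinuousLinearMap.adjoint (resolventRoot ε hα)

/-- The link between form and bounded operator: it supplies the hypothesis of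
`hasInverseGraph_associatedOperator` with `T = 1 + B_μ`. -/
theorem perturbedForm_resolventRoot (hd : d ≤ 3) {ε α : ℝ} (hε : 0 < ε) (hα : 0 < α)
    (μ : SignedMeasure (Space d)) (x y : L2 d)
    (hx : resolventRoot ε hα x ∈ H2 d) (hy : resolventRoot ε hα y ∈ H2 d) :
    perturbedForm hd ε μ ⟨_, hy⟩ ⟨_, hx⟩ +
      α * inner ℂ (resolventRoot ε hα y) (resolventRoot ε hα x) =
    inner ℂ y ((1 + measureOp hd hε hα μ) x) := by
  have h1 : (1 + measureOp hd hε hα μ) x = x + measureOp hd hε hα μ x := rfl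
  rw [h1, inner_add_right, measureOp_inner_right, ← freeForm_resolventRoot ε hα x y hx hy]
  have h2 : perturbedForm hd ε μ ⟨_, hy⟩ ⟨_, hx⟩ =
    (ε : ℂ) ^ 2 * inner ℂ (laplacianH2 d ⟨_, hy⟩) (laplacianH2 d ⟨_, hx⟩)
      + ∑ j : Fin d, inner ℂ (partialH2 j ⟨_, hy⟩) (partialH2 j ⟨_, hx⟩)
      + signedIntegral μ (fun z => starRingEnd ℂ (evalMap hd hε hα y z) *
          evalMap hd hε hα x z) := rfl
  rw [h2]
  ring

theorem hasInverseGraph_schrodinger (hd : d ≤ 3) {ε α : ℝ} (hε : 0 < ε) (hα : 0 < α)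
    {μ : SignedMeasure (Space d)}
    (hμ : greenMass d ε α * μ.totalVariation.real Set.univ ≤ 1 / 2) :
    HasInverseGraph (schrodinger hd ε μ) α (perturbedResolvent hd hε hα μ) :=
  hasInverseGraph_associatedOperator (dense_H2 d) (resolventRoot ε hα) (mem_H2_iff hε hα)
    (isUnit_one_add_measureOp hd hε hα hμ) (perturbedForm_resolventRoot hd hε hα μ)

theorem isSelfAdjoint_perturbedResolvent (hd : d ≤ 3) {ε α : ℝ} (hε : 0 < ε) (hα : 0 < α)
    (μ : SignedMeasure (Space d)) : IsSelfAdjoint (perturbedResolvent hd hε hα μ) :=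
  isSelfAdjoint_comp_inverse _ (isSelfAdjoint_one_add_measureOp hd hε hα μ)

/-- For `f = L x` the form plus `α ‖f‖²` is `⟨x, (1 + B) x⟩ ≥ ‖x‖² / 2`, so `-α` is a lower bound.
-/
theorem isLowerSemibounded_schrodinger (hd : d ≤ 3) {ε α : ℝ} (hε : 0 < ε) (hα : 0 < α)
    {μ : SignedMeasure (Space d)}
    (hμ : greenMass d ε α * μ.totalVariation.real Set.univ ≤ 1 / 2) :
    IsLowerSemibounded (schrodinger hd ε μ) := by
  refine isLowerSemibounded_associatedOperator (dense_H2 d) (γ := -α) ?_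
  rintro ⟨f, hf⟩
  obtain ⟨x, rfl⟩ := (mem_H2_iff hε hα f).1 hf
  have h1 := congrArg Complex.re (perturbedForm_resolventRoot hd hε hα μ x x hf hf)
  have h2 : (1 + measureOp hd hε hα μ) x = x + measureOp hd hε hα μ x := rfl
  rw [h2, inner_add_right, inner_self_eq_norm_sq_to_K, inner_self_eq_norm_sq_to_K] at h1
  have h3 : ‖inner ℂ x (measureOp hd hε hα μ x)‖ ≤ 1 / 2 * ‖x‖ ^ 2 :=
    (norm_inner_le_norm _ _).trans (by
      have := norm_measureOp_apply_le_half hd hε hα hμ x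
      nlinarith [norm_nonneg x])
  have h4 := (Complex.abs_re_le_norm _).trans h3
  rw [abs_le] at h4
  have e : ∀ r : ℝ, ((r : ℂ) ^ 2).re = r ^ 2 := fun r => by
    rw [← Complex.ofReal_pow, Complex.ofReal_re]
  have e2 : ∀ r : ℝ, ((α : ℂ) * (r : ℂ) ^ 2).re = α * r ^ 2 := fun r => by
    rw [← Complex.ofReal_pow, ← Complex.ofReal_mul, Complex.ofReal_re]
  change (_ + (α : ℂ) * ((‖resolventRoot ε hα x‖ : ℝ) : ℂ) ^ 2).re =
    (((‖x‖ : ℝ) : ℂ) ^ 2 + _).re at h1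
  rw [Complex.add_re, Complex.add_re, e, e2] at h1
  change -α * ‖resolventRoot ε hα x‖ ^ 2 ≤ _
  nlinarith [sq_nonneg ‖x‖]

theorem norm_resolventRoot_le (ε : ℝ) {α : ℝ} (hα : 0 < α) :
    ‖resolventRoot (d := d) ε hα‖ ≤ (√α)⁻¹ := by
  refine ContinuousLinearMap.opNorm_le_bound _ (by positivity) fun x => ?_
  have h1 : ‖resolventRoot ε hα x‖ = ‖rootMul ε hα x‖ :=
    (Lp.fourierTransformₗᵢ (Space d) ℂ).symm.norm_map _
  rw [h1]
  exact (rootMul ε hα).le_of_opNorm_le (LinearMap.mkContinuous_norm_le _ (by positivity) _) x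

theorem norm_adjoint_resolventRoot_sq_le (ε : ℝ) {α : ℝ} (hα : 0 < α) (u : L2 d) :
    ‖ContinuousLinearMap.adjoint (resolventRoot ε hα) u‖ ^ 2 ≤ α⁻¹ * ‖u‖ ^ 2 := by
  have h1 : ‖ContinuousLinearMap.adjoint (resolventRoot (d := d) ε hα)‖ ≤ (√α)⁻¹ := by
    rw [LinearIsometryEquiv.norm_map]
    exact norm_resolventRoot_le ε hα
  have h2 := (ContinuousLinearMap.adjoint (resolventRoot (d := d) ε hα)).le_of_opNorm_le h1 u
  calc _ ≤ ((√α)⁻¹ * ‖u‖) ^ 2 := by gcongr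
    _ = _ := by rw [mul_pow, inv_pow, Real.sq_sqrt hα.le]

theorem norm_inverse_adjoint_sq_le (hd : d ≤ 3) {ε α : ℝ} (hε : 0 < ε) (hα : 0 < α)
    {μ : SignedMeasure (Space d)}
    (hμ : greenMass d ε α * μ.totalVariation.real Set.univ ≤ 1 / 2) (u : L2 d) :
    ‖Ring.inverse (1 + measureOp hd hε hα μ)
      (ContinuousLinearMap.adjoint (resolventRoot ε hα) u)‖ ^ 2 ≤ 4 * α⁻¹ * ‖u‖ ^ 2 := by
  have h1 := norm_inverse_one_add_measureOp_le hd hε hα hμ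
    (ContinuousLinearMap.adjoint (resolventRoot ε hα) u)
  have h2 := norm_adjoint_resolventRoot_sq_le ε hα u
  calc _ ≤ (2 * ‖ContinuousLinearMap.adjoint (resolventRoot ε hα) u‖) ^ 2 := by gcongr
    _ ≤ _ := by rw [mul_pow]; linarith

/-- The second resolvent identity. -/
theorem inner_perturbedResolvent_sub (hd : d ≤ 3) {ε α : ℝ} (hε : 0 < ε) (hα : 0 < α)
    {μ m : SignedMeasure (Space d)}
    (hμ : greenMass d ε α * μ.totalVariation.real Set.univ ≤ 1 / 2)
    (hm : greenMass d ε α * m.totalVariation.real Set.univ ≤ 1 / 2) (v u : L2 d) :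
    inner ℂ v ((perturbedResolvent hd hε hα μ - perturbedResolvent hd hε hα m) u) =
      signedIntegral (m - μ) (fun z =>
        starRingEnd ℂ (evalMap hd hε hα (Ring.inverse (1 + measureOp hd hε hα μ)
          (ContinuousLinearMap.adjoint (resolventRoot ε hα) v)) z) *
        evalMap hd hε hα (Ring.inverse (1 + measureOp hd hε hα m)
          (ContinuousLinearMap.adjoint (resolventRoot ε hα) u)) z) := by
  have hUμ := isUnit_one_add_measureOp hd hε hα hμ
  have hUm := isUnit_one_add_measureOp hd hε hα hm
  set L := resolventRoot (d := d) ε hα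
  set Bμ := measureOp hd hε hα μ with hBμ
  set Bm := measureOp hd hε hα m with hBm
  set y := Ring.inverse (1 + Bμ) (ContinuousLinearMap.adjoint L v) with hy
  set x := Ring.inverse (1 + Bm) (ContinuousLinearMap.adjoint L u) with hx
  have hi : ∀ ν : SignedMeasure (Space d), Integrable (fun z =>
      starRingEnd ℂ (evalMap hd hε hα y z) * evalMap hd hε hα x z) ν.totalVariation := fun ν =>
    integrable_totalVariation_iff.2 (integrable_rep ν _ _)
  rw [signedIntegral_sub_measure _ _ (hi _) (hi _) (hi _), ← measureOp_inner_right,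
    ← measureOp_inner_right, ← hBμ, ← hBm]
  have h1 : (1 + Bμ) y = ContinuousLinearMap.adjoint L v :=
    congrArg (fun S : L2 d →L[ℂ] L2 d => S (ContinuousLinearMap.adjoint L v))
      (Ring.mul_inverse_cancel _ hUμ)
  have h2 : (1 + Bm) x = ContinuousLinearMap.adjoint L u :=
    congrArg (fun S : L2 d →L[ℂ] L2 d => S (ContinuousLinearMap.adjoint L u))
      (Ring.mul_inverse_cancel _ hUm)
  have hsym : ∀ a b, inner ℂ ((1 + Bμ) a) b = inner ℂ a ((1 + Bμ) b) := fun a b =>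
    (ContinuousLinearMap.isSelfAdjoint_iff_isSymmetric.1
      (isSelfAdjoint_one_add_measureOp hd hε hα μ)) a b
  have h3 : perturbedResolvent hd hε hα m u = L x := rfl
  have h4 : perturbedResolvent hd hε hα μ u =
    L (Ring.inverse (1 + Bμ) (ContinuousLinearMap.adjoint L u)) := rfl
  -- With `L* v = (1 + B_μ) y` and `L* u = (1 + B_m) x`, moving `1 + B_μ` across the scalar product
  -- leaves `⟨y, (1 + B_m) x⟩ - ⟨y, (1 + B_μ) x⟩`.
  rw [sub_apply, inner_sub_right, h3, h4, ← ContinuousLinearMap.adjoint_inner_left L,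
    ← ContinuousLinearMap.adjoint_inner_left L, ← h1, hsym, hsym, ← h2]
  have h5 : (1 + Bμ) (Ring.inverse (1 + Bμ) ((1 + Bm) x)) = (1 + Bm) x :=
    congrArg (fun S : L2 d →L[ℂ] L2 d => S ((1 + Bm) x)) (Ring.mul_inverse_cancel _ hUμ)
  rw [h5]
  simp only [add_apply, one_apply_eq_self, inner_add_right]
  ring

end MeasurePerturbation

namespace MeasurePerturbation

variable {d : ℕ}

/-! ### The error density -/

theorem lintegral_mul_sq_le {X : Type*} [MeasurableSpace X] (ρ : Measure X) {f g : X → ℝ≥0∞}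
    (hf : AEMeasurable f ρ) (hg : AEMeasurable g ρ) :
    (∫⁻ x, f x * g x ∂ρ) ^ 2 ≤ (∫⁻ x, f x ^ 2 ∂ρ) * ∫⁻ x, g x ^ 2 ∂ρ := by
  have h := ENNReal.lintegral_mul_le_Lp_mul_Lq ρ Real.HolderConjugate.two_two hf hg
  calc _ ≤ ((∫⁻ x, f x ^ (2 : ℝ) ∂ρ) ^ (1 / (2 : ℝ)) *
        (∫⁻ x, g x ^ (2 : ℝ) ∂ρ) ^ (1 / (2 : ℝ))) ^ 2 := by
        gcongr
        exact h
    _ = _ := by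
        rw [mul_pow, ← ENNReal.rpow_natCast, ← ENNReal.rpow_natCast, ← ENNReal.rpow_mul,
          ← ENNReal.rpow_mul]
        norm_num

/-- The Fourier transform of the measure `g (t - y) ν(dy)`. -/
noncomputable def greenTransform (ε α : ℝ) (ν : SignedMeasure (Space d)) (t ξ : Space d) : ℂ :=
  signedIntegral ν fun y => planeWave ξ y * green d ε α (t - y)

theorem stronglyMeasurable_greenTransform (ε α : ℝ) (ν : SignedMeasure (Space d)) :
    StronglyMeasurable (Function.uncurry (greenTransform ε α ν)) := by
  refine stronglyMeasurable_signedIntegral ν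
    (f := fun (p : Space d × Space d) y => planeWave p.2 y * green d ε α (p.1 - y)) ?_
  refine StronglyMeasurable.mul (Continuous.stronglyMeasurable (by fun_prop)) ?_
  exact (stronglyMeasurable_green d ε α).comp_measurable
    ((measurable_fst.comp measurable_fst).sub measurable_snd)

/-- Plancherel in `a`, with `g_{0,1}` as the convolved `L²` function and `g_{ε,α}(t - y) ν(dy)` as
the measure. -/
theorem errorDensity_eq (hd : d ≤ 3) {ε α : ℝ} (hε : 0 < ε) (hα : 0 < α)
    (ν : SignedMeasure (Space d)) (t : Space d) :
    errorDensity ε α ν t = ∫⁻ ξ, ‖greenSymbol d 0 1 ξ‖ₑ ^ 2 * ‖greenTransform ε α ν t ξ‖ₑ ^ 2 := by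
  have h1 : (𝓕⁻ ((memLp_greenSymbol hd 0 one_pos).toLp (greenSymbol d 0 1)) : L2 d) =ᵐ[volume]
      green d 0 1 := by
    rw [← greenL2_eq hd 0 one_pos]
    exact green_ae_eq d 0 1
  have h2 : Continuous fun y => green d ε α (t - y) :=
    (continuous_green hd hε hα).comp (by fun_prop)
  refine (lintegral_enorm_signedIntegral_sq (stronglyMeasurable_green d 0 1) h1
    h2.stronglyMeasurable (fun y => norm_green_le hd hε hα (t - y)) ν).trans ?_
  refine lintegral_congr_ae (((memLp_greenSymbol hd 0 one_pos).coeFn_toLp).mono fun ξ hξ => ?_)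
  beta_reduce
  rw [hξ]
  rfl

theorem measurable_errorDensity (hd : d ≤ 3) {ε α : ℝ} (hε : 0 < ε) (hα : 0 < α)
    (ν : SignedMeasure (Space d)) : Measurable (errorDensity ε α ν) := by
  rw [funext (errorDensity_eq hd hε hα ν)]
  refine Measurable.lintegral_prod_right' (f := fun p : Space d × Space d =>
    ‖greenSymbol d 0 1 p.2‖ₑ ^ 2 * ‖greenTransform ε α ν p.1 p.2‖ₑ ^ 2) ?_
  have h1 : Measurable fun p : Space d × Space d => ‖greenSymbol d 0 1 p.2‖ₑ ^ 2 :=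
    ((continuous_greenSymbol 0 one_pos).measurable.comp measurable_snd).enorm.pow_const 2
  have h2 : Measurable fun p : Space d × Space d => ‖greenTransform ε α ν p.1 p.2‖ₑ ^ 2 :=
    (stronglyMeasurable_greenTransform ε α ν).measurable.enorm.pow_const 2
  exact h1.mul h2

/-- This is why `g_{0,1}` occurs in the error terms: its symbol `(1 + |p|²)⁻¹` dominates the root of
the Green symbol up to a constant. -/
theorem norm_rootSymbol_le_greenSymbol {ε α : ℝ} (hε : 0 < ε) (hα : 0 < α) (ξ : Space d) :
    ‖rootSymbol ε α ξ‖ ≤ √(symbolConst ε α) * ‖greenSymbol d 0 1 ξ‖ := by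
  have h1 : symbol 0 1 ξ = 1 + (2 * Real.pi * ‖ξ‖) ^ 2 := by
    unfold symbol
    ring
  rw [norm_rootSymbol, norm_greenSymbol 0 one_pos, h1, ← div_eq_mul_inv,
    le_div_iff₀ (by positivity), inv_mul_le_iff₀ (Real.sqrt_pos.2 (symbol_pos ε hα ξ)),
    mul_comm √(symbol ε α ξ), ← Real.sqrt_mul (symbolConst_pos hε hα).le]
  exact Real.le_sqrt_of_sq_le (sq_one_add_le_symbol hε hα ξ)

/-- The measure `ν` integrated against an evaluated vector and the Green function. -/
noncomputable def pairing (hd : d ≤ 3) {ε α : ℝ} (hε : 0 < ε) (hα : 0 < α)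
    (ν : SignedMeasure (Space d)) (y : L2 d) (t : Space d) : ℂ :=
  signedIntegral ν fun z => evalMap hd hε hα y z * green d ε α (t - z)

theorem stronglyMeasurable_pairing (hd : d ≤ 3) {ε α : ℝ} (hε : 0 < ε) (hα : 0 < α)
    (ν : SignedMeasure (Space d)) (y : L2 d) :
    StronglyMeasurable (pairing hd hε hα ν y) := by
  have hc := continuous_green hd hε hα
  refine stronglyMeasurable_signedIntegral ν (f := fun t z => evalMap hd hε hα y z *
    green d ε α (t - z)) (Continuous.stronglyMeasurable ?_)
  simp only [Function.uncurry_def]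
  exact ((evalMap hd hε hα y).continuous.comp continuous_snd).mul
    (hc.comp (continuous_fst.sub continuous_snd))

/-- The evaluated vector is a superposition of plane waves with integrable density; integrating over
`ν` first produces the transform of `g(t - ·) ν`. -/
theorem pairing_eq (hd : d ≤ 3) {ε α : ℝ} (hε : 0 < ε) (hα : 0 < α)
    (ν : SignedMeasure (Space d)) (y : L2 d) (t : Space d) :
    pairing hd hε hα ν y t = ∫ ξ, rootMul ε hα y ξ * greenTransform ε α ν t ξ := by
  have h1 : ∀ z, evalMap hd hε hα y z * green d ε α (t - z) =
      ∫ ξ, rootMul ε hα y ξ * (planeWave ξ z * green d ε α (t - z)) := fun z => by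
    rw [evalMap_apply, inner_evalVector, ← integral_mul_const]
    refine integral_congr_ae ((rootMul_ae_eq ε hα y).mono fun ξ hξ => ?_)
    beta_reduce
    rw [hξ]
    ring
  unfold pairing
  simp only [h1]
  rw [signedIntegral_integral_swap]
  · simp only [signedIntegral_const_mul]
    rfl
  · refine ((integrable_rootMul hd hε hα y).comp_snd ν.totalVariation).mul_bdd
      (c := greenMass d ε α) ?_ (Eventually.of_forall fun p => ?_)
    · have hc := continuous_green hd hε hα
      refine Continuous.aestronglyMeasurable (Continuous.mul (by fun_prop) ?_)
      exact hc.comp (by fun_prop)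
    · rw [norm_mul, norm_planeWave, one_mul]
      exact norm_green_le hd hε hα _

/-- Cauchy-Schwarz in `ξ`, with the root of the Green symbol replaced by the symbol of `g_{0,1}` and
grouped with the transform, while `y` stands alone. -/
theorem enorm_pairing_sq_le (hd : d ≤ 3) {ε α : ℝ} (hε : 0 < ε) (hα : 0 < α)
    (ν : SignedMeasure (Space d)) (y : L2 d) (t : Space d) :
    ‖pairing hd hε hα ν y t‖ₑ ^ 2 ≤
      ENNReal.ofReal (symbolConst ε α * ‖y‖ ^ 2) * errorDensity ε α ν t := by
  have hκ := symbolConst_pos hε hα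
  have hgt : Measurable fun ξ => ‖greenTransform ε α ν t ξ‖ₑ :=
    ((stronglyMeasurable_greenTransform ε α ν).measurable.comp measurable_prodMk_left).enorm
  have hgs : Measurable fun ξ : Space d => ‖greenSymbol d 0 1 ξ‖ₑ :=
    (continuous_greenSymbol 0 one_pos).measurable.enorm
  have h1 : ‖pairing hd hε hα ν y t‖ₑ ≤ ∫⁻ ξ, (ENNReal.ofReal √(symbolConst ε α) * ‖y ξ‖ₑ) *
      (‖greenSymbol d 0 1 ξ‖ₑ * ‖greenTransform ε α ν t ξ‖ₑ) := by
    rw [pairing_eq]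
    refine (enorm_integral_le_lintegral_enorm _).trans (lintegral_mono_ae ?_)
    filter_upwards [rootMul_ae_eq ε hα y] with ξ hξ
    rw [hξ, enorm_mul, enorm_mul]
    have h2 : ‖rootSymbol ε α ξ‖ₑ ≤
        ENNReal.ofReal √(symbolConst ε α) * ‖greenSymbol d 0 1 ξ‖ₑ := by
      rw [← ofReal_norm, ← ofReal_norm, ← ENNReal.ofReal_mul (Real.sqrt_nonneg _)]
      exact ENNReal.ofReal_le_ofReal (norm_rootSymbol_le_greenSymbol hε hα ξ)
    calc _ ≤ (ENNReal.ofReal √(symbolConst ε α) * ‖greenSymbol d 0 1 ξ‖ₑ) * ‖y ξ‖ₑ *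
          ‖greenTransform ε α ν t ξ‖ₑ := by gcongr
      _ = _ := by ring
  refine (pow_le_pow_left' h1 2).trans ?_
  refine (lintegral_mul_sq_le volume ((Lp.aestronglyMeasurable y).enorm.const_mul _)
    (hgs.mul hgt).aemeasurable).trans_eq ?_
  rw [errorDensity_eq hd hε hα]
  simp only [Pi.mul_apply, mul_pow]
  rw [lintegral_const_mul' _ _ (by finiteness), L2.lintegral_enorm_sq, ← ofReal_norm,
    ← ENNReal.ofReal_pow (Real.sqrt_nonneg _), ← ENNReal.ofReal_pow (norm_nonneg _),
    Real.sq_sqrt hκ.le, ENNReal.ofReal_mul hκ.le]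

/-! ### The main estimate -/

/-- `L L*` is the free resolvent, hence convolution with the Green function; the reproducing kernel
property makes this a pointwise identity for the continuous representative. -/
theorem evalMap_adjoint (hd : d ≤ 3) {ε α : ℝ} (hε : 0 < ε) (hα : 0 < α) (u : L2 d)
    (z : Space d) :
    starRingEnd ℂ (evalMap hd hε hα (ContinuousLinearMap.adjoint (resolventRoot ε hα) u) z) =
      ∫ t, starRingEnd ℂ (u t) * green d ε α (t - z) := by
  rw [evalMap_apply, ContinuousLinearMap.adjoint_inner_right, inner_conj_symm,
    L2.inner_eq_integral]
  have hmem := (mem_H2_iff hε hα (resolventRoot ε hα (evalVector hd hε hα z))).2 ⟨_, rfl⟩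
  refine integral_congr_ae ((contRep_spec hd ⟨_, hmem⟩).mono fun t ht => ?_)
  simp only at ht ⊢
  rw [ht, evalMap_eq_contRep hd hε hα, evalMap_evalVector]

theorem evalMap_measureOp (hd : d ≤ 3) {ε α : ℝ} (hε : 0 < ε) (hα : 0 < α)
    (m : SignedMeasure (Space d)) (x : L2 d) (z : Space d) :
    starRingEnd ℂ (evalMap hd hε hα (measureOp hd hε hα m x) z) =
      signedIntegral m fun t => starRingEnd ℂ (evalMap hd hε hα x t) * green d ε α (t - z) := by
  rw [evalMap_apply, measureOp_inner_right, ← signedIntegral_conj]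
  simp only [evalMap_evalVector, map_mul, Complex.conj_conj, mul_comm]

/-- Substitute `x = L* u - B_m x`. Both terms on the right are convolutions with the even function
`g_{ε,α}`, so Fubini moves `ν` inside, where it forms `pairing`. Conjugating makes `ỹ` and the
kernel appear without conjugates. -/
theorem conj_signedIntegral_evalMap (hd : d ≤ 3) {ε α : ℝ} (hε : 0 < ε) (hα : 0 < α)
    (m ν : SignedMeasure (Space d)) (y x u : L2 d)
    (hx : x + measureOp hd hε hα m x = ContinuousLinearMap.adjoint (resolventRoot ε hα) u) :
    starRingEnd ℂ (signedIntegral ν fun z =>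
        starRingEnd ℂ (evalMap hd hε hα y z) * evalMap hd hε hα x z) =
      (∫ t, starRingEnd ℂ (u t) * pairing hd hε hα ν y t) -
        signedIntegral m fun t => starRingEnd ℂ (evalMap hd hε hα x t) *
          pairing hd hε hα ν y t := by
  have hc := continuous_green hd hε hα
  have hint1 : Integrable (Function.uncurry fun z t =>
      starRingEnd ℂ (u t) * (green d ε α (z - t) * evalMap hd hε hα y z))
      (ν.totalVariation.prod volume) :=
    integrable_mul_comp_sub_mul (Lp.memLp u).star
      (Complex.continuous_conj.comp_stronglyMeasurable (Lp.stronglyMeasurable u))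
      (memLp_green d ε α) (stronglyMeasurable_green d ε α)
      (evalMap hd hε hα y).continuous.stronglyMeasurable
      (evalMap hd hε hα y).norm_coe_le_norm
  have hsymm : ∀ z t : Space d, green d ε α (z - t) = green d ε α (t - z) := fun z t => by
    rw [← green_neg hd hε hα, neg_sub]
  have hint2 : Integrable (Function.uncurry fun z t => evalMap hd hε hα y z *
      (starRingEnd ℂ (evalMap hd hε hα x t) * green d ε α (t - z)))
      (ν.totalVariation.prod m.totalVariation) := by
    refine Integrable.of_bound
      (C := ‖evalMap hd hε hα y‖ * (‖evalMap hd hε hα x‖ * greenMass d ε α)) ?_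
      (Eventually.of_forall fun p => ?_)
    · refine Continuous.aestronglyMeasurable ?_
      simp only [Function.uncurry_def]
      exact ((evalMap hd hε hα y).continuous.comp continuous_fst).mul
        ((Complex.continuous_conj.comp ((evalMap hd hε hα x).continuous.comp continuous_snd)).mul
          (hc.comp (by fun_prop)))
    · simp only [Function.uncurry_def, norm_mul, RCLike.norm_conj]
      gcongr
      · exact (evalMap hd hε hα y).norm_coe_le_norm _
      · exact (evalMap hd hε hα x).norm_coe_le_norm _
      · exact norm_green_le hd hε hα _
  have hz : ∀ z, starRingEnd ℂ (starRingEnd ℂ (evalMap hd hε hα y z) * evalMap hd hε hα x z) =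
      (∫ t, starRingEnd ℂ (u t) * (green d ε α (z - t) * evalMap hd hε hα y z)) -
      signedIntegral m fun t => evalMap hd hε hα y z *
        (starRingEnd ℂ (evalMap hd hε hα x t) * green d ε α (t - z)) := by
    intro z
    have h1 : evalMap hd hε hα x z = evalMap hd hε hα
        (ContinuousLinearMap.adjoint (resolventRoot ε hα) u) z -
          evalMap hd hε hα (measureOp hd hε hα m x) z := by
      rw [← hx, map_add]
      simp
    rw [map_mul, Complex.conj_conj, h1, map_sub, evalMap_adjoint, evalMap_measureOp, mul_sub,
      signedIntegral_const_mul, ← integral_const_mul]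
    congr 1
    refine integral_congr_ae (Eventually.of_forall fun t => ?_)
    simp only [hsymm z t]
    ring
  rw [← signedIntegral_conj]
  simp only [hz]
  rw [signedIntegral_sub_fun, signedIntegral_integral_swap hint1,
    signedIntegral_signedIntegral_swap hint2]
  · congr 1
    · refine integral_congr_ae (Eventually.of_forall fun t => ?_)
      simp only [signedIntegral_const_mul, pairing]
      congr 2
      ext z
      rw [hsymm, mul_comm]
    · congr 1
      ext t
      rw [pairing, ← signedIntegral_const_mul]
      congr 1
      ext z
      ring
  · exact hint1.integral_prod_left
  · refine Integrable.of_bound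
      (C := ‖evalMap hd hε hα y‖ * (‖evalMap hd hε hα x‖ * greenMass d ε α) *
        m.totalVariation.real Set.univ) ?_ (Eventually.of_forall fun z => ?_)
    · refine (stronglyMeasurable_signedIntegral m (Continuous.stronglyMeasurable
        ?_)).aestronglyMeasurable
      simp only [Function.uncurry_def]
      exact ((evalMap hd hε hα y).continuous.comp continuous_fst).mul
        ((Complex.continuous_conj.comp ((evalMap hd hε hα x).continuous.comp continuous_snd)).mul
          (hc.comp (by fun_prop)))
    · refine norm_signedIntegral_le m fun t => ?_
      simp only [norm_mul, RCLike.norm_conj]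
      gcongr
      · exact (evalMap hd hε hα y).norm_coe_le_norm _
      · exact (evalMap hd hε hα x).norm_coe_le_norm _
      · exact norm_green_le hd hε hα _

theorem enorm_add_sq_le (a b : ℝ≥0∞) : (a + b) ^ 2 ≤ 2 * (a ^ 2 + b ^ 2) := by
  have := ENNReal.rpow_add_le_mul_rpow_add_rpow a b (p := 2) (by norm_num)
  norm_num at this
  exact_mod_cast this

/-- Cauchy-Schwarz in `t` for each of the two terms. The factor `2` comes from `(a + b)² ≤ 2 (a² +
b²)`; in the second term it cancels the `1/2` in `∫ |x̃|² d|m| ≤ g_{ε,α}(0) ‖m‖ ‖x‖² ≤ ‖x‖² / 2`. -/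
theorem enorm_signedIntegral_evalMap_sq_le (hd : d ≤ 3) {ε α : ℝ} (hε : 0 < ε) (hα : 0 < α)
    {m : SignedMeasure (Space d)} (ν : SignedMeasure (Space d))
    (hm : greenMass d ε α * m.totalVariation.real Set.univ ≤ 1 / 2) (y x u : L2 d)
    (hx : x + measureOp hd hε hα m x = ContinuousLinearMap.adjoint (resolventRoot ε hα) u) :
    ‖signedIntegral ν fun z =>
        starRingEnd ℂ (evalMap hd hε hα y z) * evalMap hd hε hα x z‖ₑ ^ 2 ≤
      ENNReal.ofReal (symbolConst ε α * ‖y‖ ^ 2) *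
        (ENNReal.ofReal (2 * ‖u‖ ^ 2) * errorTerm ε α ν +
          ENNReal.ofReal (‖x‖ ^ 2) * errorTermOn ε α ν m) := by
  set K := ENNReal.ofReal (symbolConst ε α * ‖y‖ ^ 2) with hK
  have hc := greenMass_nonneg d ε hα
  have hKtop : K ≠ ⊤ := ENNReal.ofReal_ne_top
  have hpm := (stronglyMeasurable_pairing hd hε hα ν y).measurable.enorm
  have hbound : ∀ ρ : Measure (Space d), ∫⁻ t, ‖pairing hd hε hα ν y t‖ₑ ^ 2 ∂ρ ≤
      K * ∫⁻ t, errorDensity ε α ν t ∂ρ := fun ρ => by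
    rw [← lintegral_const_mul' _ _ hKtop]
    exact lintegral_mono fun t => enorm_pairing_sq_le hd hε hα ν y t
  have h1 : ‖∫ t, starRingEnd ℂ (u t) * pairing hd hε hα ν y t‖ₑ ^ 2 ≤
      ENNReal.ofReal (‖u‖ ^ 2) * (K * errorTerm ε α ν) := by
    calc _ ≤ (∫⁻ t, ‖u t‖ₑ * ‖pairing hd hε hα ν y t‖ₑ) ^ 2 := by
          gcongr
          refine (enorm_integral_le_lintegral_enorm _).trans_eq ?_
          simp only [enorm_mul, RCLike.enorm_conj]
      _ ≤ _ := lintegral_mul_sq_le _ (Lp.aestronglyMeasurable u).enorm hpm.aemeasurable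
      _ ≤ _ := by
          rw [L2.lintegral_enorm_sq, ← ofReal_norm, ← ENNReal.ofReal_pow (norm_nonneg _)]
          gcongr
          exact hbound _
  have h2 : ‖signedIntegral m fun t => starRingEnd ℂ (evalMap hd hε hα x t) *
      pairing hd hε hα ν y t‖ₑ ^ 2 ≤
      ENNReal.ofReal (1 / 2 * ‖x‖ ^ 2) * (K * errorTermOn ε α ν m) := by
    calc _ ≤ (∫⁻ t, ‖evalMap hd hε hα x t‖ₑ * ‖pairing hd hε hα ν y t‖ₑ ∂m.totalVariation) ^ 2 := by
          gcongr
          refine (enorm_signedIntegral_le _ _).trans_eq ?_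
          simp only [enorm_mul, RCLike.enorm_conj]
      _ ≤ _ := lintegral_mul_sq_le _
          (evalMap hd hε hα x).continuous.measurable.enorm.aemeasurable hpm.aemeasurable
      _ ≤ _ := by
          gcongr
          · calc _ ≤ ∫⁻ _, ENNReal.ofReal (greenMass d ε α * ‖x‖ ^ 2) ∂m.totalVariation := by
                  refine lintegral_mono fun t => ?_
                  rw [← ofReal_norm, ← ENNReal.ofReal_pow (norm_nonneg _)]
                  refine ENNReal.ofReal_le_ofReal ?_
                  calc _ ≤ (√(greenMass d ε α) * ‖x‖) ^ 2 := by
                        gcongr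
                        exact norm_evalMap_le hd hε hα x t
                    _ = _ := by rw [mul_pow, Real.sq_sqrt hc]
              _ ≤ _ := by
                  rw [lintegral_const, ← ofReal_measureReal,
                    ← ENNReal.ofReal_mul (by positivity)]
                  refine ENNReal.ofReal_le_ofReal ?_
                  nlinarith [sq_nonneg ‖x‖]
          · exact hbound _
  have h3 := congrArg (fun c : ℂ => ‖c‖ₑ ^ 2)
    (conj_signedIntegral_evalMap hd hε hα m ν y x u hx)
  simp only [RCLike.enorm_conj] at h3
  rw [h3]
  calc _ ≤ (_ + _) ^ 2 := by
        gcongr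
        exact enorm_sub_le
    _ ≤ _ := enorm_add_sq_le _ _
    _ ≤ 2 * (ENNReal.ofReal (‖u‖ ^ 2) * (K * errorTerm ε α ν) +
        ENNReal.ofReal (1 / 2 * ‖x‖ ^ 2) * (K * errorTermOn ε α ν m)) := by gcongr
    _ = K * ((2 * ENNReal.ofReal (‖u‖ ^ 2)) * errorTerm ε α ν +
        (2 * ENNReal.ofReal (1 / 2 * ‖x‖ ^ 2)) * errorTermOn ε α ν m) := by ring
    _ = _ := by
        have e : ∀ a, 2 * ENNReal.ofReal a = ENNReal.ofReal (2 * a) := fun a => by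
          rw [ENNReal.ofReal_mul (by norm_num)]
          norm_num
        rw [e, e, show 2 * (1 / 2 * ‖x‖ ^ 2) = ‖x‖ ^ 2 by ring]

/-- Take `v = D u` and divide by `‖D u‖²`; an infinite `K` is trivial. -/
theorem enorm_opNorm_sq_le_of_forall_inner {H : Type*} [NormedAddCommGroup H]
    [InnerProductSpace ℂ H] (D : H →L[ℂ] H) (K : ℝ≥0∞)
    (h : ∀ v u, ‖inner ℂ v (D u)‖ₑ ^ 2 ≤ ENNReal.ofReal (‖v‖ ^ 2 * ‖u‖ ^ 2) * K) :
    ‖D‖ₑ ^ 2 ≤ K := by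
  rcases eq_or_ne K ⊤ with rfl | hK
  · exact le_top
  lift K to ℝ≥0 using hK
  have h1 : ‖D‖ ≤ √K := by
    refine D.opNorm_le_bound (Real.sqrt_nonneg _) fun u => ?_
    have h2 := h (D u) u
    rw [inner_self_eq_norm_sq_to_K, ← ofReal_norm, ← ENNReal.ofReal_pow (norm_nonneg _),
      ← ENNReal.ofReal_coe_nnreal, ← ENNReal.ofReal_mul (by positivity),
      ENNReal.ofReal_le_ofReal_iff (by positivity)] at h2
    have h3 : (‖D u‖ ^ 2) * ‖D u‖ ^ 2 ≤ ‖D u‖ ^ 2 * (‖u‖ ^ 2 * K) := by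
      simp only [norm_pow, RCLike.norm_ofReal, abs_norm] at h2
      linarith
    rcases eq_or_ne (‖D u‖) 0 with h0 | h0
    · rw [h0]
      positivity
    · have h4 : ‖D u‖ ^ 2 ≤ ‖u‖ ^ 2 * K := le_of_mul_le_mul_left h3 (by positivity)
      refine abs_le_of_sq_le_sq' ?_ (by positivity) |>.2
      rw [mul_pow, Real.sq_sqrt K.coe_nonneg]
      linarith
  rw [← ofReal_norm, ← ENNReal.ofReal_pow (norm_nonneg _), ← ENNReal.ofReal_coe_nnreal]
  refine ENNReal.ofReal_le_ofReal ?_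
  calc ‖D‖ ^ 2 ≤ √(K : ℝ) ^ 2 := by gcongr
    _ = (K : ℝ) := Real.sq_sqrt K.coe_nonneg

/-- The constant in front of the first error term. -/
noncomputable def errorConst (ε α : ℝ) : ℝ≥0 := (8 * symbolConst ε α / α).toNNReal

/-- The constant in front of the second error term. -/
noncomputable def errorConstOn (ε α : ℝ) : ℝ≥0 := (16 * symbolConst ε α / α ^ 2).toNNReal

/-- Both `‖y‖²` and `‖x‖²` carry a factor `4/α`: `2²` from `(1 + B)⁻¹` and `1/α` from `L*`. Hence
the constants `κ · (4/α) · 2` and `κ · (4/α)²`, with `κ` the value of `symbolConst`. -/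
theorem enorm_perturbedResolvent_sub_sq_le (hd : d ≤ 3) {ε α : ℝ} (hε : 0 < ε) (hα : 0 < α)
    {μ m : SignedMeasure (Space d)}
    (hμ : greenMass d ε α * μ.totalVariation.real Set.univ ≤ 1 / 2)
    (hm : greenMass d ε α * m.totalVariation.real Set.univ ≤ 1 / 2) :
    ‖perturbedResolvent hd hε hα μ - perturbedResolvent hd hε hα m‖ₑ ^ 2 ≤
      errorConst ε α * errorTerm ε α (m - μ) + errorConstOn ε α * errorTermOn ε α (m - μ) m := by
  have hκ := symbolConst_pos hε hα
  refine enorm_opNorm_sq_le_of_forall_inner _ _ fun v u => ?_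
  rw [inner_perturbedResolvent_sub hd hε hα hμ hm]
  set y := Ring.inverse (1 + measureOp hd hε hα μ)
    (ContinuousLinearMap.adjoint (resolventRoot ε hα) v) with hy
  set x := Ring.inverse (1 + measureOp hd hε hα m)
    (ContinuousLinearMap.adjoint (resolventRoot ε hα) u) with hx
  have hy' : ‖y‖ ^ 2 ≤ 4 * α⁻¹ * ‖v‖ ^ 2 := norm_inverse_adjoint_sq_le hd hε hα hμ v
  have hx' : ‖x‖ ^ 2 ≤ 4 * α⁻¹ * ‖u‖ ^ 2 := norm_inverse_adjoint_sq_le hd hε hα hm u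
  have hxe : x + measureOp hd hε hα m x = ContinuousLinearMap.adjoint (resolventRoot ε hα) u :=
    congrArg (fun S : L2 d →L[ℂ] L2 d => S (ContinuousLinearMap.adjoint (resolventRoot ε hα) u))
      (Ring.mul_inverse_cancel _ (isUnit_one_add_measureOp hd hε hα hm))
  refine (enorm_signedIntegral_evalMap_sq_le hd hε hα (m - μ) hm y x u hxe).trans ?_
  rw [mul_add, mul_add, ← mul_assoc, ← mul_assoc, ← mul_assoc, ← mul_assoc,
    ← ENNReal.ofReal_mul (by positivity), ← ENNReal.ofReal_mul (by positivity),
    errorConst, errorConstOn, ← ENNReal.ofReal, ← ENNReal.ofReal,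
    ← ENNReal.ofReal_mul (by positivity), ← ENNReal.ofReal_mul (by positivity)]
  refine add_le_add (mul_le_mul_left (ENNReal.ofReal_le_ofReal ?_) _)
    (mul_le_mul_left (ENNReal.ofReal_le_ofReal ?_) _)
  · calc symbolConst ε α * ‖y‖ ^ 2 * (2 * ‖u‖ ^ 2)
        ≤ symbolConst ε α * (4 * α⁻¹ * ‖v‖ ^ 2) * (2 * ‖u‖ ^ 2) := by gcongr
      _ = ‖v‖ ^ 2 * ‖u‖ ^ 2 * (8 * symbolConst ε α / α) := by ring
  · calc symbolConst ε α * ‖y‖ ^ 2 * ‖x‖ ^ 2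
        ≤ symbolConst ε α * (4 * α⁻¹ * ‖v‖ ^ 2) * (4 * α⁻¹ * ‖u‖ ^ 2) := by gcongr
      _ = ‖v‖ ^ 2 * ‖u‖ ^ 2 * (16 * symbolConst ε α / α ^ 2) := by ring

end MeasurePerturbation

namespace MeasurePerturbation

variable {d : ℕ}

/-! ### The error terms vanish in the limit -/

theorem tendsto_lintegral_mul_of_bounded {X : Type*} [MeasurableSpace X] {ρ : Measure X}
    {W : X → ℝ≥0∞} (hWm : Measurable W) (hW : ∀ x, W x ≠ ⊤) (hWi : ∫⁻ x, W x ∂ρ ≠ ⊤)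
    {G : ℕ → X → ℝ≥0∞} (hGm : ∀ n, Measurable (G n)) {C : ℝ≥0∞} (hC : C ≠ ⊤)
    (hG : ∀ n x, G n x ≤ C) (hlim : ∀ x, Tendsto (fun n => G n x) atTop (𝓝 0)) :
    Tendsto (fun n => ∫⁻ x, W x * G n x ∂ρ) atTop (𝓝 0) := by
  have h0 : ∫⁻ _, (0 : ℝ≥0∞) ∂ρ = 0 := lintegral_zero
  rw [← h0]
  refine tendsto_lintegral_of_dominated_convergence (fun x => W x * C)
    (fun n => hWm.mul (hGm n)) (fun n => Eventually.of_forall fun x =>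
      mul_le_mul_right (hG n x) (W x))
    ?_ (Eventually.of_forall fun x => ?_)
  · rw [lintegral_mul_const _ hWm]
    exact ENNReal.mul_ne_top hWi hC
  · simpa using ENNReal.Tendsto.const_mul (hlim x) (Or.inr (hW x))

theorem lintegral_enorm_greenSymbol_sq_ne_top (hd : d ≤ 3) (ε : ℝ) {α : ℝ} (hα : 0 < α) :
    ∫⁻ ξ : Space d, ‖greenSymbol d ε α ξ‖ₑ ^ 2 ≠ ⊤ := by
  have h := (memLp_greenSymbol hd ε hα).eLpNorm_lt_top
  rw [eLpNorm_lt_top_iff_lintegral_rpow_enorm_lt_top (by norm_num) (by norm_num)] at h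
  simpa using h.ne

theorem measurable_enorm_greenSymbol_sq (ε : ℝ) {α : ℝ} (hα : 0 < α) :
    Measurable fun ξ : Space d => ‖greenSymbol d ε α ξ‖ₑ ^ 2 :=
  (continuous_greenSymbol ε hα).measurable.enorm.pow_const 2

theorem enorm_signedIntegral_sub_sq_le {m μ : SignedMeasure (Space d)} {M : ℝ}
    (hM : m.totalVariation.real Set.univ + μ.totalVariation.real Set.univ ≤ M)
    {f : Space d → ℂ} {C : ℝ} (hC : 0 ≤ C) (hfm : Measurable f) (hf : ∀ x, ‖f x‖ ≤ C) :
    ‖signedIntegral (m - μ) f‖ₑ ^ 2 ≤ ENNReal.ofReal (C * M) ^ 2 := by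
  rw [← ofReal_norm]
  gcongr
  exact (norm_signedIntegral_sub_le m μ hfm hf).trans (by gcongr)

theorem WeaklyConverges.tendsto_enorm_signedIntegral_sub_sq {μ : ℕ → SignedMeasure (Space d)}
    {m : SignedMeasure (Space d)} (h : WeaklyConverges μ m) {f : Space d → ℂ}
    (hf : Continuous f) {C : ℝ} (hC : ∀ x, ‖f x‖ ≤ C) :
    Tendsto (fun n => ‖signedIntegral (m - μ n) f‖ₑ ^ 2) atTop (𝓝 0) := by
  have h1 := h.tendsto_signedIntegral_sub (BoundedContinuousFunction.ofNormedAddCommGroup f hf C hC)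
  have h2 := ENNReal.Tendsto.pow (n := 2) h1.enorm
  simpa using h2

theorem norm_planeWave_mul_green_le (hd : d ≤ 3) {ε α : ℝ} (hε : 0 < ε) (hα : 0 < α)
    (t ξ y : Space d) : ‖planeWave ξ y * green d ε α (t - y)‖ ≤ greenMass d ε α := by
  rw [norm_mul, norm_planeWave, one_mul]
  exact norm_green_le hd hε hα _

theorem continuous_planeWave_mul_green (hd : d ≤ 3) {ε α : ℝ} (hε : 0 < ε) (hα : 0 < α)
    (t ξ : Space d) : Continuous fun y => planeWave ξ y * green d ε α (t - y) := by
  have hc := continuous_green hd hε hα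
  exact Continuous.mul (by fun_prop) (hc.comp (by fun_prop))

section Limits

variable {μ : ℕ → SignedMeasure (Space d)} {m : SignedMeasure (Space d)} {M : ℝ}

theorem enorm_greenTransform_sub_sq_le (hd : d ≤ 3) {ε α : ℝ} (hε : 0 < ε) (hα : 0 < α)
    {μ : SignedMeasure (Space d)}
    (hM : m.totalVariation.real Set.univ + μ.totalVariation.real Set.univ ≤ M) (t ξ : Space d) :
    ‖greenTransform ε α (m - μ) t ξ‖ₑ ^ 2 ≤ ENNReal.ofReal (greenMass d ε α * M) ^ 2 :=
  enorm_signedIntegral_sub_sq_le hM (greenMass_nonneg d ε hα)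
    (continuous_planeWave_mul_green hd hε hα t ξ).measurable
    (norm_planeWave_mul_green_le hd hε hα t ξ)

/-- For fixed `t` and `ξ` the transform integrates a bounded continuous function of `y`, so weak
convergence applies; the squared symbol of `g_{0,1}` is the integrable weight. -/
theorem tendsto_errorDensity (hd : d ≤ 3) {ε α : ℝ} (hε : 0 < ε) (hα : 0 < α)
    (hM : ∀ n, m.totalVariation.real Set.univ + (μ n).totalVariation.real Set.univ ≤ M)
    (h : WeaklyConverges μ m) (t : Space d) :
    Tendsto (fun n => errorDensity ε α (m - μ n) t) atTop (𝓝 0) := by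
  simp only [errorDensity_eq hd hε hα]
  exact tendsto_lintegral_mul_of_bounded (measurable_enorm_greenSymbol_sq 0 one_pos)
    (fun ξ => by finiteness) (lintegral_enorm_greenSymbol_sq_ne_top hd 0 one_pos)
    (fun n => ((stronglyMeasurable_greenTransform ε α _).measurable.comp
      measurable_prodMk_left).enorm.pow_const 2)
    (ENNReal.pow_ne_top ENNReal.ofReal_ne_top)
    (fun n ξ => enorm_greenTransform_sub_sq_le hd hε hα (hM n) t ξ)
    (fun ξ => h.tendsto_enorm_signedIntegral_sub_sq (continuous_planeWave_mul_green hd hε hα t ξ)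
      (norm_planeWave_mul_green_le hd hε hα t ξ))

theorem errorDensity_sub_le (hd : d ≤ 3) {ε α : ℝ} (hε : 0 < ε) (hα : 0 < α)
    {μ : SignedMeasure (Space d)}
    (hM : m.totalVariation.real Set.univ + μ.totalVariation.real Set.univ ≤ M) (t : Space d) :
    errorDensity ε α (m - μ) t ≤
      (∫⁻ ξ : Space d, ‖greenSymbol d 0 1 ξ‖ₑ ^ 2) * ENNReal.ofReal (greenMass d ε α * M) ^ 2 := by
  rw [errorDensity_eq hd hε hα, ← lintegral_mul_const _ (measurable_enorm_greenSymbol_sq 0 one_pos)]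
  refine lintegral_mono fun ξ => ?_
  exact mul_le_mul_right (enorm_greenTransform_sub_sq_le hd hε hα hM t ξ) _

/-- Since `|m|` is finite, the uniform bound on the error density is already an integrable majorant.
-/
theorem tendsto_errorTermOn (hd : d ≤ 3) {ε α : ℝ} (hε : 0 < ε) (hα : 0 < α)
    (hM : ∀ n, m.totalVariation.real Set.univ + (μ n).totalVariation.real Set.univ ≤ M)
    (h : WeaklyConverges μ m) :
    Tendsto (fun n => errorTermOn ε α (m - μ n) m) atTop (𝓝 0) := by
  have := tendsto_lintegral_mul_of_bounded (ρ := m.totalVariation) (W := fun _ => 1)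
    measurable_const (fun _ => ENNReal.one_ne_top) (by simp)
    (fun n => measurable_errorDensity hd hε hα (m - μ n))
    (ENNReal.mul_ne_top (lintegral_enorm_greenSymbol_sq_ne_top hd 0 one_pos)
      (ENNReal.pow_ne_top ENNReal.ofReal_ne_top))
    (fun n t => errorDensity_sub_le hd hε hα (hM n) t) (tendsto_errorDensity hd hε hα hM h)
  simpa only [errorTermOn, one_mul] using this

/-- Plancherel in `t`, now with `g_{ε,α}` as the convolved function; its evenness brings the
argument into the form `y - t`. -/
theorem lintegral_enorm_greenTransform_sq (hd : d ≤ 3) {ε α : ℝ} (hε : 0 < ε) (hα : 0 < α)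
    (ν : SignedMeasure (Space d)) (ξ : Space d) :
    ∫⁻ t, ‖greenTransform ε α ν t ξ‖ₑ ^ 2 = ∫⁻ q, ‖greenSymbol d ε α q‖ₑ ^ 2 *
      ‖signedIntegral ν fun y => planeWave q y * planeWave ξ y‖ₑ ^ 2 := by
  have h1 : (𝓕⁻ ((memLp_greenSymbol hd ε hα).toLp (greenSymbol d ε α)) : L2 d) =ᵐ[volume]
      green d ε α := by
    rw [← greenL2_eq hd ε hα]
    exact green_ae_eq d ε α
  have h2 : Continuous fun y => planeWave ξ y := by fun_prop
  have h3 : ∀ t, greenTransform ε α ν t ξ =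
      signedIntegral ν fun y => green d ε α (y - t) * planeWave ξ y := fun t => by
    unfold greenTransform
    congr 1
    ext y
    rw [← green_neg hd hε hα, neg_sub, mul_comm]
  simp only [h3]
  refine (lintegral_enorm_signedIntegral_sq (stronglyMeasurable_green d ε α) h1
    h2.stronglyMeasurable (fun y => (norm_planeWave ξ y).le) ν).trans ?_
  refine lintegral_congr_ae (((memLp_greenSymbol hd ε hα).coeFn_toLp).mono fun q hq => ?_)
  beta_reduce
  rw [hq]

theorem errorTerm_eq (hd : d ≤ 3) {ε α : ℝ} (hε : 0 < ε) (hα : 0 < α)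
    (ν : SignedMeasure (Space d)) :
    errorTerm ε α ν = ∫⁻ ξ, ‖greenSymbol d 0 1 ξ‖ₑ ^ 2 * ∫⁻ t, ‖greenTransform ε α ν t ξ‖ₑ ^ 2 := by
  have hW : Measurable fun p : Space d × Space d => ‖greenSymbol d 0 1 p.2‖ₑ ^ 2 :=
    (measurable_enorm_greenSymbol_sq 0 one_pos).comp measurable_snd
  have hG : Measurable fun p : Space d × Space d => ‖greenTransform ε α ν p.1 p.2‖ₑ ^ 2 :=
    (stronglyMeasurable_greenTransform ε α ν).measurable.enorm.pow_const 2
  unfold errorTerm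
  simp only [errorDensity_eq hd hε hα]
  rw [lintegral_lintegral_swap (hW.mul hG).aemeasurable]
  refine lintegral_congr fun ξ => ?_
  rw [lintegral_const_mul' _ _ (by finiteness)]

/-- A constant majorant in `x` is useless for Lebesgue measure. After Plancherel in both variables
the weight is the product of the squared symbols of `g_{0,1}` and `g_{ε,α}`, which is integrable,
and the remaining factor is the transform of `m - μ_n` at `q + ξ`. Dominated convergence is applied
in `q` and then in `ξ`. -/
theorem tendsto_errorTerm (hd : d ≤ 3) {ε α : ℝ} (hε : 0 < ε) (hα : 0 < α)
    (hM : ∀ n, m.totalVariation.real Set.univ + (μ n).totalVariation.real Set.univ ≤ M)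
    (h : WeaklyConverges μ m) :
    Tendsto (fun n => errorTerm ε α (m - μ n)) atTop (𝓝 0) := by
  have hc : ∀ q ξ : Space d, Continuous fun y => planeWave q y * planeWave ξ y := fun q ξ => by
    fun_prop
  have hn : ∀ q ξ y : Space d, ‖planeWave q y * planeWave ξ y‖ ≤ 1 := fun q ξ y => by simp
  have hb : ∀ n q ξ, ‖signedIntegral (m - μ n) fun y => planeWave q y * planeWave ξ y‖ₑ ^ 2 ≤
      ENNReal.ofReal (1 * M) ^ 2 := fun n q ξ =>
    enorm_signedIntegral_sub_sq_le (hM n) zero_le_one (hc q ξ).measurable (hn q ξ)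
  have hWε := lintegral_enorm_greenSymbol_sq_ne_top (d := d) hd ε hα
  have hC : ENNReal.ofReal (1 * M) ^ 2 ≠ ⊤ := ENNReal.pow_ne_top ENNReal.ofReal_ne_top
  simp only [errorTerm_eq hd hε hα]
  refine tendsto_lintegral_mul_of_bounded (measurable_enorm_greenSymbol_sq 0 one_pos)
    (fun ξ => by finiteness) (lintegral_enorm_greenSymbol_sq_ne_top hd 0 one_pos)
    (fun n => ?_) (ENNReal.mul_ne_top hWε hC) (fun n ξ => ?_) fun ξ => ?_
  · exact Measurable.lintegral_prod_left' (f := fun p : Space d × Space d =>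
      ‖greenTransform ε α (m - μ n) p.1 p.2‖ₑ ^ 2)
      ((stronglyMeasurable_greenTransform ε α _).measurable.enorm.pow_const 2)
  · rw [lintegral_enorm_greenTransform_sq hd hε hα,
      ← lintegral_mul_const _ (measurable_enorm_greenSymbol_sq ε hα)]
    refine lintegral_mono fun q => ?_
    exact mul_le_mul_right (hb n q ξ) _
  · simp only [lintegral_enorm_greenTransform_sq hd hε hα]
    refine tendsto_lintegral_mul_of_bounded (measurable_enorm_greenSymbol_sq ε hα)
      (fun ξ => by finiteness) hWε (fun n => ?_) hC (fun n q => hb n q ξ)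
      fun q => h.tendsto_enorm_signedIntegral_sub_sq (hc q ξ) (hn q ξ)
    refine Measurable.pow_const (Measurable.enorm ?_) 2
    refine (stronglyMeasurable_signedIntegral (m - μ n)
      (f := fun q y => planeWave q y * planeWave ξ y)
      (Continuous.stronglyMeasurable ?_)).measurable
    simp only [Function.uncurry_def]
    fun_prop

end Limits

theorem tendsto_of_enorm_sub_sq_le {E : Type*} [NormedAddCommGroup E] {R : ℕ → E} {S : E}
    {K : ℕ → ℝ≥0∞} (h : ∀ n, ‖R n - S‖ₑ ^ 2 ≤ K n) (hK : Tendsto K atTop (𝓝 0)) :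
    Tendsto R atTop (𝓝 S) := by
  have h1 : Tendsto (fun n => ‖R n - S‖ₑ ^ 2) atTop (𝓝 0) :=
    tendsto_of_tendsto_of_tendsto_of_le_of_le tendsto_const_nhds hK (fun _ => zero_le) h
  have h2 := h1.ennrpow_const (1 / 2)
  rw [ENNReal.zero_rpow_of_pos (by norm_num)] at h2
  rw [tendsto_iff_edist_tendsto_0]
  refine h2.congr fun n => ?_
  rw [edist_eq_enorm_sub, ← ENNReal.rpow_natCast, ← ENNReal.rpow_mul]
  norm_num

end MeasurePerturbation

/-! ### Choice of the threshold and assembly of the theorem -/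

theorem theorem3 (d : ℕ) (hd1 : 1 ≤ d) (hd3 : d ≤ 3) (ε : ℝ) (hε : 0 < ε) :
    ∃ C₁ C₂ : ℝ → ℝ≥0,
      ∀ (μ : ℕ → SignedMeasure (Space d)) (m : SignedMeasure (Space d)),
        (⨆ n, totalMass (μ n)) < ⊤ → WeaklyConverges μ m →
        ((∀ n, IsSelfAdjoint (schrodinger hd3 ε (μ n)) ∧
            IsLowerSemibounded (schrodinger hd3 ε (μ n))) ∧
          IsSelfAdjoint (schrodinger hd3 ε m) ∧ IsLowerSemibounded (schrodinger hd3 ε m)) ∧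
        NormResolventConverges (fun n => schrodinger hd3 ε (μ n)) (schrodinger hd3 ε m) ∧
        ∃ α₀ : ℝ, 0 < α₀ ∧ ∀ α : ℝ, α₀ ≤ α → ∃ (R : ℕ → L2 d →L[ℂ] L2 d) (S : L2 d →L[ℂ] L2 d),
          (∀ n, IsResolvent (schrodinger hd3 ε (μ n)) (-(α : ℂ)) (R n)) ∧
          IsResolvent (schrodinger hd3 ε m) (-(α : ℂ)) S ∧
          (∀ n, ‖R n - S‖ₑ ^ 2 ≤
            C₁ α * errorTerm ε α (m - μ n) + C₂ α * errorTermOn ε α (m - μ n) m) ∧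
          Tendsto (fun n => errorTerm ε α (m - μ n)) atTop (𝓝 0) ∧
          Tendsto (fun n => errorTermOn ε α (m - μ n) m) atTop (𝓝 0) := by
  refine ⟨errorConst ε, errorConstOn ε, fun μ m hμ h => ?_⟩
  -- One bound for the masses of `m` and all `μ_n`; the mass of `m` is included by a maximum, so no
  -- lower semicontinuity under weak convergence is needed.
  obtain ⟨M, hMm, hMμ⟩ : ∃ M : ℝ, m.totalVariation.real Set.univ ≤ M ∧
      ∀ n, (μ n).totalVariation.real Set.univ ≤ M :=
    ⟨max (m.totalVariation.real Set.univ) (⨆ n, totalMass (μ n)).toReal, le_max_left _ _,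
      fun n => le_max_of_le_right (ENNReal.toReal_mono hμ.ne (le_iSup (fun n => totalMass (μ n)) n))⟩
  have hM : ∀ n, m.totalVariation.real Set.univ + (μ n).totalVariation.real Set.univ ≤ M + M :=
    fun n => add_le_add hMm (hMμ n)
  -- Because `g_{ε,α}(0) → 0`, the smallness condition holds from some `β` on that depends on the
  -- measures only through `M`. The maximum with `1` below keeps the threshold positive.
  obtain ⟨β, hβ⟩ : ∃ β : ℝ, ∀ α, β ≤ α → greenMass d ε α * M ≤ 1 / 2 := by
    have h1 := (tendsto_integral_inv_symbol hd3 hε).mul_const M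
    rw [zero_mul] at h1
    exact eventually_atTop.1 (h1.eventually_le_const one_half_pos)
  have hα₀ : 0 < max β 1 := lt_max_of_lt_right one_pos
  have hsmall : ∀ α, max β 1 ≤ α → ∀ {ν : SignedMeasure (Space d)},
      ν.totalVariation.real Set.univ ≤ M →
      greenMass d ε α * ν.totalVariation.real Set.univ ≤ 1 / 2 := fun α hα ν hν =>
    (mul_le_mul_of_nonneg_left hν (greenMass_nonneg d ε (hα₀.trans_le hα))).trans
      (hβ α ((le_max_left _ _).trans hα))
  have hs {ν : SignedMeasure (Space d)} := hsmall _ le_rfl (ν := ν)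
  have hgraph := fun n => hasInverseGraph_schrodinger hd3 hε hα₀ (hs (hMμ n))
  have hgraph' := hasInverseGraph_schrodinger hd3 hε hα₀ (hs hMm)
  have hadj := isSelfAdjoint_perturbedResolvent hd3 hε hα₀
  refine ⟨⟨fun n => ⟨(hgraph n).isSelfAdjoint (hadj _),
      isLowerSemibounded_schrodinger hd3 hε hα₀ (hs (hMμ n))⟩, hgraph'.isSelfAdjoint (hadj _),
      isLowerSemibounded_schrodinger hd3 hε hα₀ (hs hMm)⟩,
    normResolventConverges_of_tendsto hgraph hgraph' (fun n => hadj _) (hadj _) ?_,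
    max β 1, hα₀, fun α hα => ?_⟩
  · refine tendsto_of_enorm_sub_sq_le
      (fun n => enorm_perturbedResolvent_sub_sq_le hd3 hε hα₀ (hs (hMμ n)) (hs hMm)) ?_
    have h1 := ENNReal.Tendsto.const_mul (tendsto_errorTerm hd3 hε hα₀ hM h)
      (Or.inr (ENNReal.coe_ne_top (r := errorConst ε (max β 1))))
    have h2 := ENNReal.Tendsto.const_mul (tendsto_errorTermOn hd3 hε hα₀ hM h)
      (Or.inr (ENNReal.coe_ne_top (r := errorConstOn ε (max β 1))))
    simpa using h1.add h2
  · have hα' := hα₀.trans_le hα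
    exact ⟨fun n => perturbedResolvent hd3 hε hα' (μ n), perturbedResolvent hd3 hε hα' m,
      fun n => (hasInverseGraph_schrodinger hd3 hε hα' (hsmall α hα (hMμ n))).isResolvent,
      (hasInverseGraph_schrodinger hd3 hε hα' (hsmall α hα hMm)).isResolvent,
      fun n => enorm_perturbedResolvent_sub_sq_le hd3 hε hα' (hsmall α hα (hMμ n))
        (hsmall α hα hMm),
      tendsto_errorTerm hd3 hε hα' hM h, tendsto_errorTermOn hd3 hε hα' hM h⟩
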